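/- **Setting.** Let $\mathcal M=(\mathcal S,\mathcal A,H,p,r,d,\alpha)$ be a finite-horizon constrained MDP with finite state and action sets, horizon $H$, fixed initial state $s_1$, transition kernels $p_h(\cdot\mid s,a)$, rewards $r_h(s,a)\in[0,1]$, constraint signals $d_{i,h}(s,a)\in[0,1]$ and thresholds $\alpha_i\in[0,H]$, $i=1,\dots,m$, $m\ge 1$. For a Markov policy $\pi$ put $V_v^\pi=\mathbb E_{\pi,p}\bigl[\sum_{h=1}^H v_h(s_h,a_h)\mid s_1\bigr]$, and let $\pi^\star$ be any maximizer of $V_r^\pi$ subject to $V_{d_i}^\pi\ge\alpha_i$ for all $i$. Assume Slater's condition: there are a policy $\pi^0$ and numbers $d_i^0>\alpha_i$ with $V_{d_i}^{\pi^0}\ge d_i^0$ for all $i$; let $\Xi=\min_i(d_i^0-\alpha_i)$ and $\mathcal C=[0,4H/\Xi]^m$. **Algorithm (FlexDOME, known model).** Given step sizes $\eta_t>0$, a regularization parameter $\tau>0$ and safety margins $\epsilon_i>0$, start from $\pi_{1,h}(a\mid s)=1/|\mathcal A|$, $\lambda_1=0$, and for $t=1,2,\dots$ set $$\pi_{t+1,h}(a\mid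 s)\propto\pi_{t,h}(a\mid s)\exp\bigl(\eta_t\hat Q^t_h(s,a)\bigr),\qquad \lambda_{t+1}=\mathrm{Proj}_{\mathcal C}\bigl((1-\eta_t\tau)\lambda_t-\eta_t(\hat V_d^t-\epsilon-\alpha)\bigr),$$ where $\hat Q^t_h=\hat Q^t_{r,h}+\sum_i\lambda_{t,i}\hat Q^t_{d_i,h}+\tau\hat Q^t_{\psi_t,h}$ with $\psi_{t,h}(s,a)=-\log\pi_{t,h}(a\mid s)$. For a signal $v$ the functions $\hat Q^t_{v,h}$ are computed backwards from $\hat V^t_{v,H+1}=0$ by $$\hat Q^t_{v,h}(s,a)=\min\Bigl\{v_h(s,a)+\sum_{s'}p_h(s'\mid s,a)\hat V^t_{v,h+1}(s'),\;b_{v,h}(s,a)\Bigr\},\qquad \hat V^t_{v,h}(s)=\sum_a\pi_{t,h}(a\mid s)\hat Q^t_{v,h}(s,a),$$ with truncation level $b_{v,h}=H-h+1$ for $v=r,d_i$ and $b_{\psi_t,h}=\psi_{t,h}+(H-h+1)\log|\mathcal A|$; and $\hat V_d^t=(\hat V^t_{d_i,1}(s_1))_i$. **Theorem (last-iterate convergence).**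 For all constants $0<c_\eta\le c_\eta'$ and $0<c_\tau\le c_\tau'$ there are $K>0$ and $C_0>0$ such that for all $c_\epsilon'\ge c_\epsilon\ge C_0$ there are $C>0$ and $\varepsilon_0>0$ with the following property. (All these constants may depend on $\mathcal M$, $\pi^0$ and $d^0$.) Let $0<\varepsilon<\varepsilon_0$, and suppose that $$c_\eta\varepsilon^3\le\eta_t\le c_\eta'\varepsilon^3\ (t\ge 1),\qquad c_\tau\varepsilon\le\tau\le c_\tau'\varepsilon,\qquad c_\epsilon\varepsilon\le\epsilon_i\le c_\epsilon'\varepsilon\ (i=1,\dots,m).$$ Then for every integer $t\ge 1$ with $t\ge K\varepsilon^{-4}\log(1/\varepsilon)$, $$\bigl[V_r^{\pi^\star}-V_r^{\pi_t}\bigr]_+\le C\varepsilon\qquad\text{and}\qquad\bigl[\alpha_i-V_{d_i}^{\pi_t}\bigr]_+=0\quad\text{for all }i .$$ That is, with $\eta_t=\Theta(\varepsilon^3)$, $\tau=\Theta(\varepsilon)$, $\epsilon_i=\Theta(\varepsilon)$ (the constant of the margins being large enough) and $t=\Omega(\varepsilon^{-4}\log(1/\varepsilon))$, the last iterate is $O(\varepsilon)$-optimal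 and satisfies every constraint exactly. -/

import Mathlib

open scoped BigOperators

/-- A finite-horizon constrained Markov decision process with `m` constraints, finite state space
`S` and finite action space `A`. Steps are numbered `0, …, H - 1` (the step usually called `h` is
`h - 1` here); data at indices `≥ H` play no role. -/
structure CMDP (S A : Type*) [Fintype S] [Fintype A] (m : ℕ) where
  /-- horizon -/
  H : ℕ
  /-- initial state -/
  s₁ : S
  /-- transition probabilities `p h s a s' = p_h(s' | s, a)` -/
  p : ℕ → S → A → S → ℝ
  /-- (mean) reward -/
  r : ℕ → S → A → ℝ
  /-- (mean) constraint signals -/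
  d : Fin m → ℕ → S → A → ℝ
  /-- (mean) thresholds -/
  α : Fin m → ℝ
  p_mem : ∀ h < H, ∀ s a, p h s a ∈ stdSimplex ℝ S
  r_mem : ∀ h < H, ∀ s a, r h s a ∈ Set.Icc (0 : ℝ) 1
  d_mem : ∀ i, ∀ h < H, ∀ s a, d i h s a ∈ Set.Icc (0 : ℝ) 1
  α_mem : ∀ i, α i ∈ Set.Icc (0 : ℝ) H

namespace CMDP

noncomputable section

variable {S A : Type*} [Fintype S] [Fintype A] [DecidableEq S] {m : ℕ}

/-- `π` is a (Markov, randomized) policy: `π h s` is a distribution on the actions, for every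
step `h` of the horizon and every state `s`. -/
def IsPolicy (M : CMDP S A m) (π : ℕ → S → A → ℝ) : Prop :=
  ∀ h < M.H, ∀ s, π h s ∈ stdSimplex ℝ A

/-- The probability `P_{π,p}[s_h = s | s₁]` that the state at step `h` is `s`. -/
def stateProb (M : CMDP S A m) (π : ℕ → S → A → ℝ) : ℕ → S → ℝ
  | 0, s => if s = M.s₁ then 1 else 0
  | h + 1, s' => ∑ s, ∑ a, stateProb M π h s * π h s a * M.p h s a s'

/-- The value `V_v^π = E_{π,p}[∑_h v_h(s_h, a_h) | s₁]`. -/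
def value (M : CMDP S A m) (v : ℕ → S → A → ℝ) (π : ℕ → S → A → ℝ) : ℝ :=
  ∑ h ∈ Finset.range M.H, ∑ s, ∑ a, stateProb M π h s * π h s a * v h s a

/-- `π` satisfies all constraints, `V_{d_i}^π ≥ α_i`. -/
def IsFeasible (M : CMDP S A m) (π : ℕ → S → A → ℝ) : Prop :=
  M.IsPolicy π ∧ ∀ i, M.α i ≤ M.value (M.d i) π

/-- `π` solves the constrained problem: it maximizes `V_r` among the feasible policies. -/
def IsOptimal (M : CMDP S A m) (π : ℕ → S → A → ℝ) : Prop :=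
  M.IsFeasible π ∧ ∀ π', M.IsFeasible π' → M.value M.r π' ≤ M.value M.r π

/-- Slater's condition, witnessed by the policy `π₀` and the levels `d₀`. -/
def IsSlater (M : CMDP S A m) (π₀ : ℕ → S → A → ℝ) (d₀ : Fin m → ℝ) : Prop :=
  M.IsPolicy π₀ ∧ ∀ i, d₀ i ≤ M.value (M.d i) π₀ ∧ M.α i < d₀ i

/-- The Slater gap `Ξ = min_i (d₀_i - α_i)`. -/
def slaterGap (M : CMDP S A m) (d₀ : Fin m → ℝ) : ℝ :=
  ⨅ i, (d₀ i - M.α i)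

/-! Truncated policy evaluation. The recursion runs backwards from the end of the horizon, so the
functions carry the number of remaining steps; `cap k h s a` is the truncation level at step `h`
when `k` steps, counting step `h` itself, remain (`k = H - h` in the numbering from `0`). -/

/-- Truncated value of the signal `v` under `π` from state `s` at step `h`, with a given number
of remaining steps. -/
def tpeV (M : CMDP S A m) (π v : ℕ → S → A → ℝ) (cap : ℕ → ℕ → S → A → ℝ) : ℕ → ℕ → S → ℝ
  | 0, _, _ => 0
  | k + 1, h, s => ∑ a, π h s a *
      min (v h s a + ∑ s', M.p h s a s' * tpeV M π v cap k (h + 1) s') (cap (k + 1) h s a)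

/-- Truncated `Q`-value of the signal `v` under `π` at step `h < H`. -/
def tpeQ (M : CMDP S A m) (π v : ℕ → S → A → ℝ) (cap : ℕ → ℕ → S → A → ℝ)
    (h : ℕ) (s : S) (a : A) : ℝ :=
  min (v h s a + ∑ s', M.p h s a s' * tpeV M π v cap (M.H - (h + 1)) (h + 1) s')
    (cap (M.H - h) h s a)

/-- Truncation level for rewards and constraints: the number of remaining steps. -/
def stepCap (k : ℕ) (_ : ℕ) (_ : S) (_ : A) : ℝ := k

/-- The entropy signal `ψ_h(s, a) = -log π_h(a | s)`. -/
def entropySignal (π : ℕ → S → A → ℝ) (h : ℕ) (s : S) (a : A) : ℝ := -Real.log (π h s a)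

/-- Truncation level for the entropy signal. -/
def entropyCap (π : ℕ → S → A → ℝ) (k : ℕ) (h : ℕ) (s : S) (a : A) : ℝ :=
  entropySignal π h s a + k * Real.log (Fintype.card A)

/-- The `Q`-value of the composite signal `y = r + λᵀ d + τ ψ`. -/
def compositeQ (M : CMDP S A m) (τ : ℝ) (π : ℕ → S → A → ℝ) (lam : Fin m → ℝ)
    (h : ℕ) (s : S) (a : A) : ℝ :=
  M.tpeQ π M.r stepCap h s a + ∑ i, lam i * M.tpeQ π (M.d i) stepCap h s a
    + τ * M.tpeQ π (entropySignal π) (entropyCap π) h s a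

/-- Mirror-ascent (multiplicative weights) policy update with step size `η`. -/
def policyUpdate (M : CMDP S A m) (η τ : ℝ) (π : ℕ → S → A → ℝ) (lam : Fin m → ℝ)
    (h : ℕ) (s : S) (a : A) : ℝ :=
  π h s a * Real.exp (η * M.compositeQ τ π lam h s a) /
    ∑ b, π h s b * Real.exp (η * M.compositeQ τ π lam h s b)

/-- Projected gradient update of the dual variables, with margins `marg`; the projection onto the
box `[0, 4H/Ξ]^m` is coordinatewise clipping. -/
def dualUpdate (M : CMDP S A m) (Ξ η τ : ℝ) (marg : Fin m → ℝ) (π : ℕ → S → A → ℝ)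
    (lam : Fin m → ℝ) (i : Fin m) : ℝ :=
  max 0 (min (4 * M.H / Ξ)
    ((1 - η * τ) * lam i - η * (M.tpeV π (M.d i) stepCap M.H 0 M.s₁ - marg i - M.α i)))

/-- The iterates of FlexDOME with known model (all estimates equal to the true quantities, no
exploration bonus), with step sizes `η t`, regularizations `τ t` and safety margins `marg t i`
for the episodes `t = 1, 2, …`. Entry `n` is the pair `(π_{n+1}, λ_{n+1})` of episode `n + 1`. -/
def flexIterate (M : CMDP S A m) (Ξ : ℝ) (η τ : ℕ → ℝ) (marg : ℕ → Fin m → ℝ) :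
    ℕ → (ℕ → S → A → ℝ) × (Fin m → ℝ)
  | 0 => (fun _ _ _ => 1 / (Fintype.card A : ℝ), fun _ => 0)
  | n + 1 =>
    let x := flexIterate M Ξ η τ marg n
    (M.policyUpdate (η (n + 1)) (τ (n + 1)) x.1 x.2,
      M.dualUpdate Ξ (η (n + 1)) (τ (n + 1)) (marg (n + 1)) x.1 x.2)

/-- The policy `π_t` that FlexDOME (with known model) plays in episode `t ≥ 1`. -/
def flexPolicy (M : CMDP S A m) (Ξ : ℝ) (η τ : ℕ → ℝ) (marg : ℕ → Fin m → ℝ) (t : ℕ) :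
    ℕ → S → A → ℝ :=
  (flexIterate M Ξ η τ marg (t - 1)).1

end

end CMDP

namespace CMDP

noncomputable section

set_option linter.unusedSectionVars false

variable {S A : Type*} [Fintype S] [Fintype A] [DecidableEq S] {m : ℕ}

/-! Write `b = α + marg` for the tightened thresholds. Adding `τ` times the entropy of the policy
and `τ/2 ‖λ‖²` makes the Lagrangian strongly curved on both sides, so that the primal-dual iteration
contracts towards a saddle point `(π', mu)` instead of circling around it. The distance that
contracts is `potential`: the relative entropy of `π'` from the iterate, weighted by the state
distribution of `π'`, plus half the squared dual distance. The weights do not change with the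
iterate, so the one-step estimate for multiplicative weights can be averaged over states. The
performance difference identity (`stateSum_compositeQ`) turns its linear term into a gap of
regularized values plus `τ` times the relative entropy. With the projected gradient estimate for the
dual and the saddle inequalities this gives `Φ_{n+1} ≤ (1 - ητ) Φ_n + η² E` (`potential_update_le`).

The stationary level is `ηE/τ = O(ε²)`, and the initial potential is forgotten at rate `ητ`, of
order `ε⁴`; this explains `ε⁻⁴ log(1/ε)`. A Pinsker bound converts relative entropy `O(ε²)` into
value differences `O(ε)` (`abs_value_sub_value_le`).

The saddle point itself is nearly optimal: its reward loses at most the entropy bonus and the price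
of the margins (`IsSaddle.value_ge`). Slater's condition keeps `mu` strictly below the upper end of
the box, so the constraints with thresholds `b` fail by at most `τL`, where `L = 4H/Ξ`
(`IsSaddle.constraint_ge`). Both this bias and the distance from iterate to saddle are `O(ε)`, with
constants independent of the margins, so large enough margins absorb them and the original
constraints hold exactly.

Two facts make the analysis legitimate: truncation is never active, and `τψ` stays bounded along the
iteration (`IsAdmissible.update`), which bounds the exponents of the multiplicative weights. -/

/-! ### State distributions and sums along the horizon -/

theorem stateProb_nonneg {M : CMDP S A m} {π : ℕ → S → A → ℝ} (hπ : M.IsPolicy π) :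
    ∀ h ≤ M.H, ∀ s, 0 ≤ M.stateProb π h s
  | 0, _, s => by
    simp only [stateProb]; split_ifs <;> norm_num
  | h + 1, hh, s' => by
    simp only [stateProb]
    refine Finset.sum_nonneg fun s _ => Finset.sum_nonneg fun a _ => ?_
    exact mul_nonneg (mul_nonneg (stateProb_nonneg hπ h (by omega) s)
      ((hπ h (by omega) s).1 a)) ((M.p_mem h (by omega) s a).1 s')

/-- Pushing a function of the next state through one step of the state distribution. -/
theorem sum_stateProb_succ_mul (M : CMDP S A m) (π : ℕ → S → A → ℝ) (h : ℕ) (f : S → ℝ) :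
    ∑ s', M.stateProb π (h + 1) s' * f s' =
      ∑ s, M.stateProb π h s * ∑ a, π h s a * ∑ s', M.p h s a s' * f s' := by
  simp only [stateProb, Finset.sum_mul, Finset.mul_sum]
  rw [Finset.sum_comm]
  refine Finset.sum_congr rfl fun s _ => ?_
  rw [Finset.sum_comm]
  refine Finset.sum_congr rfl fun a _ => Finset.sum_congr rfl fun s' _ => ?_
  ring

theorem sum_stateProb {M : CMDP S A m} {π : ℕ → S → A → ℝ} (hπ : M.IsPolicy π) :
    ∀ h ≤ M.H, ∑ s, M.stateProb π h s = 1
  | 0, _ => by simp [stateProb]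
  | h + 1, hh => by
    have := sum_stateProb_succ_mul M π h (fun _ => 1)
    simp only [mul_one] at this
    rw [this, ← sum_stateProb hπ h (by omega)]
    refine Finset.sum_congr rfl fun s _ => ?_
    simp [(M.p_mem h (by omega) s _).2, (hπ h (by omega) s).2]

/-- Expectation, summed over the horizon, of a function of the state. -/
def stateSum (M : CMDP S A m) (π : ℕ → S → A → ℝ) (f : ℕ → S → ℝ) : ℝ :=
  ∑ h ∈ Finset.range M.H, ∑ s, M.stateProb π h s * f h s

theorem value_eq_stateSum (M : CMDP S A m) (v π : ℕ → S → A → ℝ) :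
    M.value v π = M.stateSum π fun h s => ∑ a, π h s a * v h s a := by
  simp only [value, stateSum, Finset.mul_sum, mul_assoc]

theorem stateSum_mono {M : CMDP S A m} {π : ℕ → S → A → ℝ} (hπ : M.IsPolicy π)
    {f g : ℕ → S → ℝ} (hfg : ∀ h < M.H, ∀ s, f h s ≤ g h s) :
    M.stateSum π f ≤ M.stateSum π g := by
  refine Finset.sum_le_sum fun h hh => Finset.sum_le_sum fun s _ => ?_
  have hh := Finset.mem_range.1 hh
  exact mul_le_mul_of_nonneg_left (hfg h hh s) (stateProb_nonneg hπ h hh.le s)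

theorem stateSum_congr {M : CMDP S A m} {π : ℕ → S → A → ℝ}
    {f g : ℕ → S → ℝ} (hfg : ∀ h < M.H, ∀ s, f h s = g h s) :
    M.stateSum π f = M.stateSum π g :=
  Finset.sum_congr rfl fun h hh => Finset.sum_congr rfl fun s _ => by
    rw [hfg h (Finset.mem_range.1 hh) s]

theorem stateSum_add (M : CMDP S A m) (π : ℕ → S → A → ℝ) (f g : ℕ → S → ℝ) :
    (M.stateSum π fun h s => f h s + g h s) = M.stateSum π f + M.stateSum π g := by
  simp only [stateSum, mul_add, Finset.sum_add_distrib]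

theorem stateSum_sub (M : CMDP S A m) (π : ℕ → S → A → ℝ) (f g : ℕ → S → ℝ) :
    (M.stateSum π fun h s => f h s - g h s) = M.stateSum π f - M.stateSum π g := by
  simp only [stateSum, mul_sub, Finset.sum_sub_distrib]

theorem stateSum_const_mul (M : CMDP S A m) (π : ℕ → S → A → ℝ) (c : ℝ) (f : ℕ → S → ℝ) :
    (M.stateSum π fun h s => c * f h s) = c * M.stateSum π f := by
  simp only [stateSum, Finset.mul_sum, mul_left_comm]

theorem stateSum_const {M : CMDP S A m} {π : ℕ → S → A → ℝ} (hπ : M.IsPolicy π) (c : ℝ) :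
    (M.stateSum π fun _ _ => c) = M.H * c := by
  simp only [stateSum, ← Finset.sum_mul]
  congr 1
  rw [Finset.sum_congr rfl fun h hh => sum_stateProb hπ h (Finset.mem_range.1 hh).le]
  simp

/-- Telescoping along the horizon. -/
theorem eq_stateSum_of_terminal_zero (M : CMDP S A m) (π : ℕ → S → A → ℝ) (F : ℕ → S → ℝ)
    (hF : ∀ s, F M.H s = 0) :
    F 0 M.s₁ = M.stateSum π fun h s =>
      F h s - ∑ a, π h s a * ∑ s', M.p h s a s' * F (h + 1) s' := by
  have key : ∀ h, ∑ s, M.stateProb π h s *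
      (F h s - ∑ a, π h s a * ∑ s', M.p h s a s' * F (h + 1) s') =
      ∑ s, M.stateProb π h s * F h s - ∑ s, M.stateProb π (h + 1) s * F (h + 1) s := by
    intro h
    rw [sum_stateProb_succ_mul]
    simp only [mul_sub, Finset.sum_sub_distrib]
  simp only [stateSum, key]
  rw [Finset.sum_range_sub']
  simp [hF, stateProb]

theorem value_add (M : CMDP S A m) (π v w : ℕ → S → A → ℝ) :
    M.value (fun h s a => v h s a + w h s a) π = M.value v π + M.value w π := by
  simp only [value, mul_add, Finset.sum_add_distrib]

theorem value_const_mul (M : CMDP S A m) (π v : ℕ → S → A → ℝ) (c : ℝ) :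
    M.value (fun h s a => c * v h s a) π = c * M.value v π := by
  simp only [value, Finset.mul_sum, mul_left_comm]

theorem value_sum {ι : Type*} (s : Finset ι) (M : CMDP S A m) (π : ℕ → S → A → ℝ)
    (v : ι → ℕ → S → A → ℝ) :
    M.value (fun h x a => ∑ i ∈ s, v i h x a) π = ∑ i ∈ s, M.value (v i) π := by
  classical
  induction s using Finset.induction_on with
  | empty => simp [value]
  | insert i s hi ih => simp only [Finset.sum_insert hi, value_add, ih]

/-! ### Averages over a simplex, entropy, and bounds on values -/

theorem sum_mul_le_of_mem_stdSimplex {ι : Type*} [Fintype ι] {q : ι → ℝ}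
    (hq : q ∈ stdSimplex ℝ ι) {f : ι → ℝ} {c : ℝ} (hf : ∀ i, f i ≤ c) : ∑ i, q i * f i ≤ c := by
  calc ∑ i, q i * f i ≤ ∑ i, q i * c :=
        Finset.sum_le_sum fun i _ => mul_le_mul_of_nonneg_left (hf i) (hq.1 i)
    _ = c := by rw [← Finset.sum_mul, hq.2, one_mul]

theorem sum_mul_nonneg_of_mem_stdSimplex {ι : Type*} [Fintype ι] {q : ι → ℝ}
    (hq : q ∈ stdSimplex ℝ ι) {f : ι → ℝ} (hf : ∀ i, 0 ≤ f i) : 0 ≤ ∑ i, q i * f i :=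
  Finset.sum_nonneg fun i _ => mul_nonneg (hq.1 i) (hf i)

/-- The Gibbs variational inequality. -/
theorem sum_mul_sub_log_le {ι : Type*} [Fintype ι] [Nonempty ι] {q : ι → ℝ}
    (hq : q ∈ stdSimplex ℝ ι) (f : ι → ℝ) :
    ∑ i, q i * (f i - Real.log (q i)) ≤ Real.log (∑ i, Real.exp (f i)) := by
  have hZ : 0 < ∑ i, Real.exp (f i) := Finset.sum_pos (fun i _ => Real.exp_pos _)
    Finset.univ_nonempty
  set Z := ∑ i, Real.exp (f i) with hZdef
  -- This is `log x ≤ x - 1` at `x = exp (f i) / (Z q i)`; the corrections `exp (f i) / Z - q i` sum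
  -- to zero.
  have h1 : ∀ i, q i * (f i - Real.log (q i)) ≤ q i * Real.log Z + (Real.exp (f i) / Z - q i) := by
    intro i
    rcases (hq.1 i).eq_or_lt with h0 | h0
    · rw [← h0]; simp only [zero_mul, zero_add, sub_zero]; positivity
    · have := Real.log_le_sub_one_of_pos (x := Real.exp (f i) / Z / q i) (by positivity)
      rw [Real.log_div (by positivity) h0.ne', Real.log_div (by positivity) hZ.ne',
        Real.log_exp] at this
      have h2 := mul_le_mul_of_nonneg_left this h0.le
      have h3 : q i * (Real.exp (f i) / Z / q i - 1) = Real.exp (f i) / Z - q i := by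
        field_simp
      rw [h3] at h2
      linarith
  calc _ ≤ ∑ i, (q i * Real.log Z + (Real.exp (f i) / Z - q i)) :=
        Finset.sum_le_sum fun i _ => h1 i
    _ = Real.log Z := by
        rw [Finset.sum_add_distrib, Finset.sum_sub_distrib, ← Finset.sum_mul, hq.2,
          ← Finset.sum_div, ← hZdef, div_self hZ.ne']
        ring

theorem entropy_nonneg {ι : Type*} [Fintype ι] {q : ι → ℝ} (hq : q ∈ stdSimplex ℝ ι) :
    0 ≤ ∑ i, q i * -Real.log (q i) :=
  sum_mul_nonneg_of_mem_stdSimplex hq fun i => by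
    have : q i ≤ 1 := hq.2 ▸ Finset.single_le_sum (fun j _ => hq.1 j) (Finset.mem_univ i)
    have := Real.log_nonpos (hq.1 i) this
    linarith

theorem entropy_le_log_card {ι : Type*} [Fintype ι] [Nonempty ι] {q : ι → ℝ}
    (hq : q ∈ stdSimplex ℝ ι) :
    ∑ i, q i * -Real.log (q i) ≤ Real.log (Fintype.card ι) := by
  simpa using sum_mul_sub_log_le hq fun _ => 0

theorem value_nonneg {M : CMDP S A m} {v π : ℕ → S → A → ℝ} (hπ : M.IsPolicy π)
    (hv : ∀ h < M.H, ∀ s a, 0 ≤ v h s a) : 0 ≤ M.value v π := by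
  have := stateSum_mono hπ (f := fun _ _ => 0) (g := fun h s => ∑ a, π h s a * v h s a)
    fun h hh s => sum_mul_nonneg_of_mem_stdSimplex (hπ h hh s) (hv h hh s)
  rwa [stateSum_const hπ, mul_zero, ← value_eq_stateSum] at this

theorem value_le {M : CMDP S A m} {v π : ℕ → S → A → ℝ} (hπ : M.IsPolicy π)
    (hv : ∀ h < M.H, ∀ s a, v h s a ≤ 1) : M.value v π ≤ M.H := by
  have := stateSum_mono hπ (g := fun _ _ => 1) (f := fun h s => ∑ a, π h s a * v h s a)
    fun h hh s => sum_mul_le_of_mem_stdSimplex (hπ h hh s) (hv h hh s)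
  rwa [stateSum_const hπ, mul_one, ← value_eq_stateSum] at this

theorem value_entropySignal_nonneg {M : CMDP S A m} {π : ℕ → S → A → ℝ} (hπ : M.IsPolicy π) :
    0 ≤ M.value (entropySignal π) π := by
  have := stateSum_mono hπ (f := fun _ _ => 0)
    (g := fun h s => ∑ a, π h s a * entropySignal π h s a)
    fun h hh s => entropy_nonneg (hπ h hh s)
  rwa [stateSum_const hπ, mul_zero, ← value_eq_stateSum] at this

theorem value_entropySignal_le [Nonempty A] {M : CMDP S A m} {π : ℕ → S → A → ℝ}
    (hπ : M.IsPolicy π) :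
    M.value (entropySignal π) π ≤ M.H * Real.log (Fintype.card A) := by
  have := stateSum_mono hπ (g := fun _ _ => Real.log (Fintype.card A))
    (f := fun h s => ∑ a, π h s a * entropySignal π h s a)
    fun h hh s => entropy_le_log_card (hπ h hh s)
  rwa [stateSum_const hπ, ← value_eq_stateSum] at this

/-! ### Truncated policy evaluation -/

theorem tpeV_eq_sum_tpeQ (M : CMDP S A m) (π v : ℕ → S → A → ℝ) (cap : ℕ → ℕ → S → A → ℝ)
    {h : ℕ} (hh : h < M.H) (s : S) :
    M.tpeV π v cap (M.H - h) h s = ∑ a, π h s a * M.tpeQ π v cap h s a := by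
  obtain ⟨k, hk⟩ : ∃ k, M.H - h = k + 1 := ⟨M.H - h - 1, by omega⟩
  have hk' : M.H - (h + 1) = k := by omega
  simp only [tpeQ, hk, hk', tpeV]

/-- The truncation is never active: the `Q`-values of the truncated evaluation satisfy the plain
Bellman equation. -/
def IsUntruncated (M : CMDP S A m) (π v : ℕ → S → A → ℝ) (cap : ℕ → ℕ → S → A → ℝ) : Prop :=
  ∀ h < M.H, ∀ s a, M.tpeQ π v cap h s a =
    v h s a + ∑ s', M.p h s a s' * M.tpeV π v cap (M.H - (h + 1)) (h + 1) s'

theorem tpeV_stepCap_mem {M : CMDP S A m} {π v : ℕ → S → A → ℝ} (hπ : M.IsPolicy π)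
    (hv : ∀ h < M.H, ∀ s a, v h s a ∈ Set.Icc (0 : ℝ) 1) :
    ∀ k h, h + k ≤ M.H → ∀ s, M.tpeV π v stepCap k h s ∈ Set.Icc (0 : ℝ) k
  | 0, _, _, _ => by simp [tpeV]
  | k + 1, h, hk, s => by
    have ih := tpeV_stepCap_mem hπ hv k (h + 1) (by omega)
    have hh : h < M.H := by omega
    simp only [tpeV]
    refine ⟨sum_mul_nonneg_of_mem_stdSimplex (hπ h hh s) fun a => ?_,
      sum_mul_le_of_mem_stdSimplex (hπ h hh s) fun a => min_le_right _ _⟩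
    refine le_min (add_nonneg (hv h hh s a).1
      (sum_mul_nonneg_of_mem_stdSimplex (M.p_mem h hh s a) fun s' => (ih s').1)) ?_
    simp only [stepCap]; positivity

/-- A signal of at most 1 plus a continuation bounded by the number of steps left after this one
cannot exceed the cap. -/
theorem isUntruncated_stepCap {M : CMDP S A m} {π v : ℕ → S → A → ℝ} (hπ : M.IsPolicy π)
    (hv : ∀ h < M.H, ∀ s a, v h s a ∈ Set.Icc (0 : ℝ) 1) :
    M.IsUntruncated π v stepCap := by
  intro h hh s a
  refine min_eq_left ?_
  have h1 := sum_mul_le_of_mem_stdSimplex (M.p_mem h hh s a) fun s' =>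
    (tpeV_stepCap_mem hπ hv (M.H - (h + 1)) (h + 1) (by omega) s').2
  have h2 : ((M.H - h : ℕ) : ℝ) = (M.H - (h + 1) : ℕ) + 1 := by
    norm_cast; omega
  simp only [stepCap, h2]
  linarith [(hv h hh s a).2]

theorem tpeQ_stepCap_mem {M : CMDP S A m} {π v : ℕ → S → A → ℝ} (hπ : M.IsPolicy π)
    (hv : ∀ h < M.H, ∀ s a, v h s a ∈ Set.Icc (0 : ℝ) 1) {h : ℕ} (hh : h < M.H) (s : S) (a : A) :
    M.tpeQ π v stepCap h s a ∈ Set.Icc (0 : ℝ) M.H := by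
  constructor
  · rw [isUntruncated_stepCap hπ hv h hh]
    exact add_nonneg (hv h hh s a).1 (sum_mul_nonneg_of_mem_stdSimplex (M.p_mem h hh s a)
      fun s' => (tpeV_stepCap_mem hπ hv _ _ (by omega) s').1)
  · refine (min_le_right _ _).trans ?_
    simp only [stepCap]
    exact_mod_cast Nat.sub_le _ _

/-- All action probabilities are positive. -/
def IsPosPolicy (M : CMDP S A m) (π : ℕ → S → A → ℝ) : Prop :=
  ∀ h < M.H, ∀ s a, 0 < π h s a

theorem entropySignal_nonneg {M : CMDP S A m} {π : ℕ → S → A → ℝ} (hπ : M.IsPolicy π)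
    {h : ℕ} (hh : h < M.H) (s : S) (a : A) : 0 ≤ entropySignal π h s a := by
  have : π h s a ≤ 1 := (hπ h hh s).2 ▸
    Finset.single_le_sum (fun j _ => (hπ h hh s).1 j) (Finset.mem_univ a)
  have := Real.log_nonpos ((hπ h hh s).1 a) this
  simp only [entropySignal]
  linarith

theorem log_card_nonneg (A : Type*) [Fintype A] : 0 ≤ Real.log (Fintype.card A) :=
  Real.log_natCast_nonneg _

/-- The signal `-log π` is unbounded, but its average under `π` is an entropy, so each remaining
step adds at most `log |A|` to the value. This keeps the continuation below the slack in
`entropyCap`. -/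
theorem tpeV_entropyCap_mem [Nonempty A] {M : CMDP S A m} {π : ℕ → S → A → ℝ}
    (hπ : M.IsPolicy π) :
    ∀ k h, h + k ≤ M.H → ∀ s, M.tpeV π (entropySignal π) (entropyCap π) k h s ∈
      Set.Icc (0 : ℝ) (k * Real.log (Fintype.card A))
  | 0, _, _, _ => by simp [tpeV]
  | k + 1, h, hk, s => by
    have ih := tpeV_entropyCap_mem hπ k (h + 1) (by omega)
    have hh : h < M.H := by omega
    have hψ := entropySignal_nonneg hπ hh s
    have hl := log_card_nonneg A
    simp only [tpeV]
    constructor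
    · refine sum_mul_nonneg_of_mem_stdSimplex (hπ h hh s) fun a => ?_
      refine le_min (add_nonneg (hψ a)
        (sum_mul_nonneg_of_mem_stdSimplex (M.p_mem h hh s a) fun s' => (ih s').1)) ?_
      exact add_nonneg (hψ a) (by positivity)
    · calc _ ≤ ∑ a, (π h s a * -Real.log (π h s a)
              + π h s a * (k * Real.log (Fintype.card A))) := by
            refine Finset.sum_le_sum fun a _ => ?_
            rw [← mul_add]
            refine mul_le_mul_of_nonneg_left ((min_le_left _ _).trans ?_) ((hπ h hh s).1 a)
            exact add_le_add le_rfl (sum_mul_le_of_mem_stdSimplex (M.p_mem h hh s a)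
              fun s' => (ih s').2)
        _ ≤ Real.log (Fintype.card A) + k * Real.log (Fintype.card A) := by
            rw [Finset.sum_add_distrib, ← Finset.sum_mul, (hπ h hh s).2, one_mul]
            exact add_le_add (entropy_le_log_card (hπ h hh s)) le_rfl
        _ = _ := by push_cast; ring

theorem isUntruncated_entropyCap [Nonempty A] {M : CMDP S A m} {π : ℕ → S → A → ℝ}
    (hπ : M.IsPolicy π) : M.IsUntruncated π (entropySignal π) (entropyCap π) := by
  intro h hh s a
  refine min_eq_left ?_
  have h1 := sum_mul_le_of_mem_stdSimplex (M.p_mem h hh s a) fun s' =>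
    (tpeV_entropyCap_mem hπ (M.H - (h + 1)) (h + 1) (by omega) s').2
  have h2 : ((M.H - h : ℕ) : ℝ) = (M.H - (h + 1) : ℕ) + 1 := by
    norm_cast; omega
  simp only [entropyCap, h2]
  linarith [log_card_nonneg A]

theorem tpeQ_entropyCap_mem [Nonempty A] {M : CMDP S A m} {π : ℕ → S → A → ℝ}
    (hπ : M.IsPolicy π) {h : ℕ} (hh : h < M.H) (s : S) (a : A) :
    M.tpeQ π (entropySignal π) (entropyCap π) h s a ∈
      Set.Icc (entropySignal π h s a)
        (entropySignal π h s a + M.H * Real.log (Fintype.card A)) := by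
  constructor
  · rw [isUntruncated_entropyCap hπ h hh]
    exact le_add_of_nonneg_right (sum_mul_nonneg_of_mem_stdSimplex (M.p_mem h hh s a)
      fun s' => (tpeV_entropyCap_mem hπ _ _ (by omega) s').1)
  · refine (min_le_right _ _).trans ?_
    simp only [entropyCap]
    have : ((M.H - h : ℕ) : ℝ) ≤ M.H := by exact_mod_cast Nat.sub_le _ _
    nlinarith [log_card_nonneg A]

/-- Performance difference: the untruncated evaluation of `π` along the trajectories of `π'`. -/
theorem tpeV_eq_stateSum {M : CMDP S A m} {π v : ℕ → S → A → ℝ} {cap : ℕ → ℕ → S → A → ℝ}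
    (hu : M.IsUntruncated π v cap) (π' : ℕ → S → A → ℝ) :
    M.tpeV π v cap M.H 0 M.s₁ = (M.stateSum π' fun h s =>
      ∑ a, (π h s a - π' h s a) * M.tpeQ π v cap h s a) + M.value v π' := by
  have := eq_stateSum_of_terminal_zero M π' (fun h s => M.tpeV π v cap (M.H - h) h s)
    (by simp [tpeV])
  simp only [Nat.sub_zero] at this
  rw [this, value_eq_stateSum, ← stateSum_add]
  refine stateSum_congr fun h hh s => ?_
  rw [tpeV_eq_sum_tpeQ M π v cap hh, ← Finset.sum_sub_distrib, ← Finset.sum_add_distrib]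
  refine Finset.sum_congr rfl fun a _ => ?_
  rw [hu h hh]
  ring

theorem tpeV_eq_value {M : CMDP S A m} {π v : ℕ → S → A → ℝ} {cap : ℕ → ℕ → S → A → ℝ}
    (hu : M.IsUntruncated π v cap) : M.tpeV π v cap M.H 0 M.s₁ = M.value v π := by
  rw [tpeV_eq_stateSum hu π]
  simp [stateSum]

theorem value_sub_value {M : CMDP S A m} {π v : ℕ → S → A → ℝ} {cap : ℕ → ℕ → S → A → ℝ}
    (hu : M.IsUntruncated π v cap) (π' : ℕ → S → A → ℝ) :
    M.value v π' - M.value v π = M.stateSum π' fun h s =>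
      ∑ a, (π' h s a - π h s a) * M.tpeQ π v cap h s a := by
  rw [← tpeV_eq_value hu, tpeV_eq_stateSum hu π', sub_add_cancel_right, neg_eq_neg_one_mul,
    ← stateSum_const_mul]
  refine stateSum_congr fun h hh s => ?_
  rw [Finset.mul_sum]
  refine Finset.sum_congr rfl fun a _ => ?_
  ring

/-! ### The regularized Lagrangian -/

/-- The signal `r + λᵀ d`. -/
def lagSignal (M : CMDP S A m) (lam : Fin m → ℝ) (h : ℕ) (s : S) (a : A) : ℝ :=
  M.r h s a + ∑ i, lam i * M.d i h s a

/-- The value of `r + λᵀ d + τ ψ_π` under `π`. -/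
def regValue (M : CMDP S A m) (τ : ℝ) (lam : Fin m → ℝ) (π : ℕ → S → A → ℝ) : ℝ :=
  M.value (fun h s a => M.lagSignal lam h s a + τ * entropySignal π h s a) π

theorem regValue_eq (M : CMDP S A m) (τ : ℝ) (lam : Fin m → ℝ) (π : ℕ → S → A → ℝ) :
    M.regValue τ lam π = M.value M.r π + ∑ i, lam i * M.value (M.d i) π
      + τ * M.value (entropySignal π) π := by
  have h1 : M.regValue τ lam π =
      M.value (fun h s a => (M.r h s a + ∑ i, lam i * M.d i h s a)
        + τ * entropySignal π h s a) π := rfl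
  rw [h1, value_add, value_const_mul, value_add,
    value_sum Finset.univ M π fun i h s a => lam i * M.d i h s a]
  simp only [value_const_mul]

/-- The regularized Lagrangian with thresholds `b`. -/
def lagrangian (M : CMDP S A m) (τ : ℝ) (b lam : Fin m → ℝ) (π : ℕ → S → A → ℝ) : ℝ :=
  M.regValue τ lam π - ∑ i, lam i * b i + τ / 2 * ∑ i, lam i ^ 2

/-- The derivative of the regularized Lagrangian in the `i`-th dual variable. -/
def dualGrad (M : CMDP S A m) (τ : ℝ) (b lam : Fin m → ℝ) (π : ℕ → S → A → ℝ) (i : Fin m) : ℝ :=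
  M.value (M.d i) π - b i + τ * lam i

/-- The Lagrangian is quadratic in the dual variable with Hessian `τ`, so its second-order Taylor
expansion is exact. -/
theorem lagrangian_eq_add (M : CMDP S A m) (τ : ℝ) (b lam mu : Fin m → ℝ)
    (π : ℕ → S → A → ℝ) :
    M.lagrangian τ b mu π = M.lagrangian τ b lam π
      + ∑ i, (mu i - lam i) * M.dualGrad τ b lam π i + τ / 2 * ∑ i, (mu i - lam i) ^ 2 := by
  simp only [lagrangian, regValue_eq, dualGrad]
  have : ∑ i, mu i * M.value (M.d i) π - ∑ i, mu i * b i + τ / 2 * ∑ i, mu i ^ 2 =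
      ∑ i, lam i * M.value (M.d i) π - ∑ i, lam i * b i + τ / 2 * ∑ i, lam i ^ 2
      + ∑ i, (mu i - lam i) * (M.value (M.d i) π - b i + τ * lam i)
      + τ / 2 * ∑ i, (mu i - lam i) ^ 2 := by
    simp only [Finset.mul_sum, ← Finset.sum_add_distrib, ← Finset.sum_sub_distrib]
    refine Finset.sum_congr rfl fun i _ => ?_
    ring
  linarith

/-! ### Soft value iteration -/

/-- The soft-optimal value function for the signal `g`, from step `h` with a given number of
remaining steps. -/
def softV (M : CMDP S A m) (τ : ℝ) (g : ℕ → S → A → ℝ) : ℕ → ℕ → S → ℝ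
  | 0, _, _ => 0
  | k + 1, h, s =>
    τ * Real.log (∑ a, Real.exp ((g h s a + ∑ s', M.p h s a s' * softV M τ g k (h + 1) s') / τ))

/-- The soft-optimal action-value function. -/
def softQ (M : CMDP S A m) (τ : ℝ) (g : ℕ → S → A → ℝ) (h : ℕ) (s : S) (a : A) : ℝ :=
  g h s a + ∑ s', M.p h s a s' * M.softV τ g (M.H - (h + 1)) (h + 1) s'

/-- The soft-optimal (Gibbs) policy. -/
def softPolicy (M : CMDP S A m) (τ : ℝ) (g : ℕ → S → A → ℝ) (h : ℕ) (s : S) (a : A) : ℝ :=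
  Real.exp ((M.softQ τ g h s a - M.softV τ g (M.H - h) h s) / τ)

theorem softV_eq (M : CMDP S A m) (τ : ℝ) (g : ℕ → S → A → ℝ) {h : ℕ} (hh : h < M.H) (s : S) :
    M.softV τ g (M.H - h) h s = τ * Real.log (∑ a, Real.exp (M.softQ τ g h s a / τ)) := by
  obtain ⟨k, hk⟩ : ∃ k, M.H - h = k + 1 := ⟨M.H - h - 1, by omega⟩
  have hk' : M.H - (h + 1) = k := by omega
  simp only [softQ, hk, hk', softV]

theorem softPolicy_isPosPolicy (M : CMDP S A m) (τ : ℝ) (g : ℕ → S → A → ℝ) :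
    M.IsPosPolicy (M.softPolicy τ g) := fun _ _ _ _ => Real.exp_pos _

theorem softPolicy_isPolicy [Nonempty A] (M : CMDP S A m) {τ : ℝ} (hτ : 0 < τ)
    (g : ℕ → S → A → ℝ) : M.IsPolicy (M.softPolicy τ g) := by
  intro h hh s
  refine ⟨fun a => (Real.exp_pos _).le, ?_⟩
  have hZ : 0 < ∑ a, Real.exp (M.softQ τ g h s a / τ) :=
    Finset.sum_pos (fun i _ => Real.exp_pos _) Finset.univ_nonempty
  simp only [softPolicy, softV_eq M τ g hh, sub_div, Real.exp_sub, mul_div_cancel_left₀ _ hτ.ne',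
    Real.exp_log hZ, ← Finset.sum_div, div_self hZ.ne']

/-- Telescope `softV` along the trajectories of `π` and apply the Gibbs inequality to `softQ / τ` at
each state. -/
theorem value_entropy_le_softV [Nonempty A] (M : CMDP S A m) {τ : ℝ} (hτ : 0 < τ)
    (g : ℕ → S → A → ℝ) {π : ℕ → S → A → ℝ} (hπ : M.IsPolicy π) :
    M.value (fun h s a => g h s a + τ * entropySignal π h s a) π ≤ M.softV τ g M.H 0 M.s₁ := by
  have := eq_stateSum_of_terminal_zero M π (fun h s => M.softV τ g (M.H - h) h s)
    (by simp [softV])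
  simp only [Nat.sub_zero] at this
  rw [this, value_eq_stateSum]
  refine stateSum_mono hπ fun h hh s => ?_
  have h1 := mul_le_mul_of_nonneg_left
    (sum_mul_sub_log_le (hπ h hh s) fun a => M.softQ τ g h s a / τ) hτ.le
  rw [← softV_eq M τ g hh] at h1
  refine le_sub_iff_add_le.2 (le_trans (le_of_eq ?_) h1)
  rw [← Finset.sum_add_distrib, Finset.mul_sum]
  refine Finset.sum_congr rfl fun a _ => ?_
  simp only [softQ, entropySignal]
  field_simp
  ring

/-- The Gibbs inequality is an equality for the Gibbs policy, since `τ log π = softQ - softV` there.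
-/
theorem value_entropy_softPolicy [Nonempty A] (M : CMDP S A m) {τ : ℝ} (hτ : 0 < τ)
    (g : ℕ → S → A → ℝ) :
    M.value (fun h s a => g h s a + τ * entropySignal (M.softPolicy τ g) h s a)
      (M.softPolicy τ g) = M.softV τ g M.H 0 M.s₁ := by
  have := eq_stateSum_of_terminal_zero M (M.softPolicy τ g)
    (fun h s => M.softV τ g (M.H - h) h s) (by simp [softV])
  simp only [Nat.sub_zero] at this
  rw [this, value_eq_stateSum]
  refine stateSum_congr fun h hh s => ?_
  rw [eq_sub_iff_add_eq, ← Finset.sum_add_distrib]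
  calc _ = ∑ a, M.softPolicy τ g h s a * M.softV τ g (M.H - h) h s := by
        refine Finset.sum_congr rfl fun a _ => ?_
        have : τ * entropySignal (M.softPolicy τ g) h s a =
            M.softV τ g (M.H - h) h s - M.softQ τ g h s a := by
          simp only [entropySignal, softPolicy, Real.log_exp]
          field_simp
          ring
        rw [this, softQ]
        ring
    _ = _ := by rw [← Finset.sum_mul, (softPolicy_isPolicy M hτ g h hh s).2, one_mul]

/-- Continuity in the signal serves twice: a minimizer of the dual function exists on the compact
box, and best responses converge along a segment ending at it. -/
theorem continuous_softV [Nonempty A] (M : CMDP S A m) (τ : ℝ) {X : Type*} [TopologicalSpace X]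
    {g : X → ℕ → S → A → ℝ} (hg : ∀ h s a, Continuous fun x => g x h s a) :
    ∀ k h s, Continuous fun x => M.softV τ (g x) k h s
  | 0, _, _ => continuous_const
  | k + 1, h, s => by
    have ih := continuous_softV M τ hg k (h + 1)
    simp only [softV]
    refine continuous_const.mul (Continuous.log ?_ fun x => ?_)
    · refine continuous_finsetSum _ fun a _ => Real.continuous_exp.comp ?_
      exact ((hg h s a).add (continuous_finsetSum _ fun s' _ =>
        continuous_const.mul (ih s'))).div_const _
    · exact (Finset.sum_pos (fun i _ => Real.exp_pos _) Finset.univ_nonempty).ne'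

theorem continuous_softPolicy [Nonempty A] (M : CMDP S A m) (τ : ℝ) {X : Type*}
    [TopologicalSpace X] {g : X → ℕ → S → A → ℝ} (hg : ∀ h s a, Continuous fun x => g x h s a)
    (h : ℕ) (s : S) (a : A) : Continuous fun x => M.softPolicy τ (g x) h s a := by
  simp only [softPolicy, softQ]
  refine Real.continuous_exp.comp (Continuous.div_const (Continuous.sub ?_ ?_) _)
  · exact (hg h s a).add (continuous_finsetSum _ fun s' _ =>
        continuous_const.mul (continuous_softV M τ hg _ _ s'))
  · exact continuous_softV M τ hg _ _ s

theorem continuous_stateProb (M : CMDP S A m) {X : Type*} [TopologicalSpace X]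
    {π : X → ℕ → S → A → ℝ} (hπ : ∀ h s a, Continuous fun x => π x h s a) :
    ∀ h s, Continuous fun x => M.stateProb (π x) h s
  | 0, _ => continuous_const
  | h + 1, s' => by
    have ih := continuous_stateProb M hπ h
    simp only [stateProb]
    exact continuous_finsetSum _ fun s _ => continuous_finsetSum _ fun a _ =>
      ((ih s).mul (hπ h s a)).mul continuous_const

theorem continuous_value (M : CMDP S A m) (v : ℕ → S → A → ℝ) {X : Type*} [TopologicalSpace X]
    {π : X → ℕ → S → A → ℝ} (hπ : ∀ h s a, Continuous fun x => π x h s a) :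
    Continuous fun x => M.value v (π x) :=
  continuous_finsetSum _ fun h _ => continuous_finsetSum _ fun s _ =>
    continuous_finsetSum _ fun a _ =>
      ((continuous_stateProb M hπ h s).mul (hπ h s a)).mul continuous_const

theorem continuous_lagSignal (M : CMDP S A m) (h : ℕ) (s : S) (a : A) :
    Continuous fun lam => M.lagSignal lam h s a :=
  continuous_const.add (continuous_finsetSum _ fun i _ =>
    (continuous_apply i).mul continuous_const)

/-! ### Saddle points -/

/-- The policy that maximizes the regularized Lagrangian at the dual variable `lam`. -/
def bestResponse (M : CMDP S A m) (τ : ℝ) (lam : Fin m → ℝ) : ℕ → S → A → ℝ :=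
  M.softPolicy τ (M.lagSignal lam)

theorem lagrangian_le_bestResponse [Nonempty A] (M : CMDP S A m) {τ : ℝ} (hτ : 0 < τ)
    (b lam : Fin m → ℝ) {π : ℕ → S → A → ℝ} (hπ : M.IsPolicy π) :
    M.lagrangian τ b lam π ≤ M.lagrangian τ b lam (M.bestResponse τ lam) := by
  have h1 := value_entropy_le_softV M hτ (M.lagSignal lam) hπ
  have h2 := value_entropy_softPolicy M hτ (M.lagSignal lam)
  simp only [lagrangian, regValue, bestResponse]
  rw [h2]
  linarith

theorem continuous_lagrangian_bestResponse [Nonempty A] (M : CMDP S A m) {τ : ℝ} (hτ : 0 < τ)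
    (b : Fin m → ℝ) :
    Continuous fun lam => M.lagrangian τ b lam (M.bestResponse τ lam) := by
  have : (fun lam => M.lagrangian τ b lam (M.bestResponse τ lam)) = fun lam =>
      M.softV τ (M.lagSignal lam) M.H 0 M.s₁ - ∑ i, lam i * b i + τ / 2 * ∑ i, lam i ^ 2 := by
    funext lam
    simp only [lagrangian, regValue, bestResponse]
    rw [value_entropy_softPolicy M hτ]
  rw [this]
  have := continuous_softV M τ (g := fun lam => M.lagSignal lam) (continuous_lagSignal M) M.H 0 M.s₁
  fun_prop

/-- A minimizer of the dual function over the box `[0, L]^m` satisfies the variational inequality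
for the constraint values of the best response. -/
theorem exists_dual_variational [Nonempty A] (M : CMDP S A m) {τ : ℝ} (hτ : 0 < τ)
    (b : Fin m → ℝ) {L : ℝ} (hL : 0 ≤ L) :
    ∃ lam : Fin m → ℝ, (∀ i, lam i ∈ Set.Icc 0 L) ∧
      ∀ mu : Fin m → ℝ, (∀ i, mu i ∈ Set.Icc 0 L) →
        0 ≤ ∑ i, (mu i - lam i) * M.dualGrad τ b lam (M.bestResponse τ lam) i := by
  obtain ⟨lam, hlam, hmin⟩ := (isCompact_Icc (a := (0 : Fin m → ℝ)) (b := fun _ => L)).exists_isMinOn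
    ⟨0, le_rfl, fun _ => hL⟩ (continuous_lagrangian_bestResponse M hτ b).continuousOn
  refine ⟨lam, fun i => ⟨hlam.1 i, hlam.2 i⟩, fun mu hmu => ?_⟩
  let x : ℝ → Fin m → ℝ := fun u i => lam i + u * (mu i - lam i)
  have hx : Continuous x := by fun_prop
  -- An envelope argument that never differentiates the dual function: `u * f u` is the change of
  -- the Lagrangian from `lam` to `x u` with the policy frozen at the best response to `x u`.
  let f : ℝ → ℝ := fun u => ∑ i, (mu i - lam i) * M.dualGrad τ b lam (M.bestResponse τ (x u)) i
    + u * (τ / 2 * ∑ i, (mu i - lam i) ^ 2)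
  have hf : Continuous f := by
    have : ∀ i, Continuous fun u => M.value (M.d i) (M.bestResponse τ (x u)) := fun i =>
      continuous_value M (M.d i) fun h s a =>
        (continuous_softPolicy M τ (g := fun lam => M.lagSignal lam) (continuous_lagSignal M)
          h s a).comp hx
    simp only [f, dualGrad]
    fun_prop
  have hpos : ∀ u ∈ Set.Ioo (0 : ℝ) 1, 0 ≤ f u := by
    intro u hu
    have hmem : x u ∈ Set.Icc (0 : Fin m → ℝ) (fun _ => L) := by
      constructor <;> intro i <;> simp only [x, Pi.zero_apply]
      · nlinarith [hu.1, hu.2, (hmu i).1, hlam.1 i, mul_nonneg hu.1.le (hmu i).1,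
          mul_nonneg (sub_nonneg.2 hu.2.le) (hlam.1 i)]
      · nlinarith [mul_nonneg hu.1.le (sub_nonneg.2 (hmu i).2),
          mul_nonneg (sub_nonneg.2 hu.2.le) (sub_nonneg.2 (hlam.2 i))]
    have h1 := hmin hmem
    simp only [Set.mem_ofPred_eq] at h1
    -- Frozen at the best response to `x u`, the Lagrangian at `lam` is at most the dual function at
    -- `lam`, hence by minimality at most its own value at `x u`. So `u * f u ≥ 0`.
    have h2 := lagrangian_le_bestResponse M hτ b lam
      (softPolicy_isPolicy M hτ (M.lagSignal (x u)))
    have h3 := lagrangian_eq_add M τ b lam (x u) (M.bestResponse τ (x u))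
    have h4 : u * f u = ∑ i, (x u i - lam i) * M.dualGrad τ b lam (M.bestResponse τ (x u)) i
        + τ / 2 * ∑ i, (x u i - lam i) ^ 2 := by
      simp only [f, x, mul_add, Finset.mul_sum, ← Finset.sum_add_distrib]
      refine Finset.sum_congr rfl fun i _ => ?_
      ring
    have h5 : 0 ≤ u * f u := by
      rw [h4]
      change M.lagrangian τ b lam (M.bestResponse τ (x u)) ≤ _ at h2
      linarith
    exact nonneg_of_mul_nonneg_right h5 hu.1
  have hlim : Filter.Tendsto f (nhdsWithin 0 (Set.Ioi 0)) (nhds (f 0)) :=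
    hf.continuousAt.tendsto.mono_left nhdsWithin_le_nhds
  have h0 : 0 ≤ f 0 := ge_of_tendsto hlim
    (Filter.mem_of_superset (Ioo_mem_nhdsGT one_pos) hpos)
  simpa [f, x] using h0

/-- `(π, lam)` is a saddle point of the regularized Lagrangian over positive policies and the
box `[0, L]^m`, in first-order form for the dual variable. -/
structure IsSaddle (M : CMDP S A m) (τ : ℝ) (b : Fin m → ℝ) (L : ℝ) (π : ℕ → S → A → ℝ)
    (lam : Fin m → ℝ) : Prop where
  isPolicy : M.IsPolicy π
  isPosPolicy : M.IsPosPolicy π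
  dual_mem : ∀ i, lam i ∈ Set.Icc 0 L
  primal_opt : ∀ π', M.IsPolicy π' → M.lagrangian τ b lam π' ≤ M.lagrangian τ b lam π
  dual_opt : ∀ mu : Fin m → ℝ, (∀ i, mu i ∈ Set.Icc 0 L) →
    0 ≤ ∑ i, (mu i - lam i) * M.dualGrad τ b lam π i

theorem exists_isSaddle [Nonempty A] (M : CMDP S A m) {τ : ℝ} (hτ : 0 < τ)
    (b : Fin m → ℝ) {L : ℝ} (hL : 0 ≤ L) : ∃ π lam, M.IsSaddle τ b L π lam := by
  obtain ⟨lam, h1, h2⟩ := exists_dual_variational M hτ b hL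
  exact ⟨M.bestResponse τ lam, lam, softPolicy_isPolicy M hτ _, softPolicy_isPosPolicy M τ _, h1,
    fun π' hπ' => lagrangian_le_bestResponse M hτ b lam hπ', h2⟩

theorem IsSaddle.le_lagrangian {M : CMDP S A m} {τ : ℝ} {b : Fin m → ℝ} {L : ℝ}
    {π : ℕ → S → A → ℝ} {lam : Fin m → ℝ} (hs : M.IsSaddle τ b L π lam) (hτ : 0 ≤ τ)
    {mu : Fin m → ℝ} (hmu : ∀ i, mu i ∈ Set.Icc 0 L) :
    M.lagrangian τ b lam π ≤ M.lagrangian τ b mu π := by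
  rw [lagrangian_eq_add M τ b lam mu]
  have := hs.dual_opt mu hmu
  have : 0 ≤ τ / 2 * ∑ i, (mu i - lam i) ^ 2 :=
    mul_nonneg (by linarith) (Finset.sum_nonneg fun i _ => sq_nonneg _)
  linarith

/-- The reward of the saddle-point policy against the Lagrangian of any policy `π'`. -/
theorem IsSaddle.value_ge [Nonempty A] {M : CMDP S A m} {τ : ℝ} {b : Fin m → ℝ} {L : ℝ}
    {π : ℕ → S → A → ℝ} {lam : Fin m → ℝ} (hs : M.IsSaddle τ b L π lam) (hτ : 0 ≤ τ)
    (hL : 0 ≤ L) {π' : ℕ → S → A → ℝ} (hπ' : M.IsPolicy π') :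
    M.value M.r π' + ∑ i, lam i * (M.value (M.d i) π' - b i) ≤
      M.value M.r π + τ * (M.H * Real.log (Fintype.card A)) := by
  have h1 := hs.primal_opt π' hπ'
  -- At dual variable 0 the constraint and quadratic terms vanish, leaving only reward and entropy
  -- of the saddle policy.
  have h2 := hs.le_lagrangian hτ (mu := fun _ => 0) fun i => ⟨le_rfl, hL⟩
  have h3 := mul_nonneg hτ (value_entropySignal_nonneg hπ')
  have h4 := mul_le_mul_of_nonneg_left (value_entropySignal_le hs.isPolicy) hτ
  have h5 : 0 ≤ τ / 2 * ∑ i, lam i ^ 2 :=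
    mul_nonneg (by linarith) (Finset.sum_nonneg fun i _ => sq_nonneg _)
  have h6 : M.lagrangian τ b (fun _ => 0) π = M.value M.r π + τ * M.value (entropySignal π) π := by
    simp [lagrangian, regValue_eq]
  have h7 : M.lagrangian τ b lam π' = M.value M.r π' + ∑ i, lam i * (M.value (M.d i) π' - b i)
      + τ * M.value (entropySignal π') π' + τ / 2 * ∑ i, lam i ^ 2 := by
    simp only [lagrangian, regValue_eq, mul_sub, Finset.sum_sub_distrib]
    ring
  linarith

/-- Under Slater's condition the dual variable stays off the upper end of the box, so that the
constraints hold up to the regularization. -/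
theorem IsSaddle.constraint_ge [Nonempty A] {M : CMDP S A m} {τ : ℝ} {b : Fin m → ℝ} {Ξ : ℝ}
    {π : ℕ → S → A → ℝ} {lam : Fin m → ℝ} (hs : M.IsSaddle τ b (4 * M.H / Ξ) π lam)
    (hτ : 0 ≤ τ) (hτ' : τ * Real.log (Fintype.card A) < 1) (hH : 0 < M.H) (hΞ : 0 < Ξ)
    {π₀ : ℕ → S → A → ℝ} (hπ₀ : M.IsPolicy π₀) (hb : ∀ i, Ξ / 2 ≤ M.value (M.d i) π₀ - b i)
    (i : Fin m) : b i - τ * (4 * M.H / Ξ) ≤ M.value (M.d i) π := by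
  have hH' : (0 : ℝ) < M.H := by exact_mod_cast hH
  have hL : 0 ≤ 4 * M.H / Ξ := by positivity
  have h1 := hs.value_ge hτ hL hπ₀
  have h2 : 0 ≤ M.value M.r π₀ := value_nonneg hπ₀ fun h hh s a => (M.r_mem h hh s a).1
  have h3 : M.value M.r π ≤ M.H := value_le hs.isPolicy fun h hh s a => (M.r_mem h hh s a).2
  have h4 : lam i * (Ξ / 2) ≤ ∑ j, lam j * (M.value (M.d j) π₀ - b j) :=
    (mul_le_mul_of_nonneg_left (hb i) (hs.dual_mem i).1).trans
      (Finset.single_le_sum (f := fun j => lam j * (M.value (M.d j) π₀ - b j))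
        (fun j _ => mul_nonneg (hs.dual_mem j).1 (by linarith [hb j])) (Finset.mem_univ i))
  -- With the bounds above, `lam i * (Ξ / 2) ≤ H + τ H log |A| < 2H`; hence the side `4H/Ξ` of the
  -- box.
  have h5 : τ * (M.H * Real.log (Fintype.card A)) < M.H := by nlinarith
  have h6 : lam i < 4 * M.H / Ξ := by
    rw [lt_div_iff₀ hΞ]
    linarith
  -- Raise the `i`-th coordinate alone to the end of the box. Since `lam i` is strictly below it,
  -- the partial derivative must be nonnegative.
  have h7 := hs.dual_opt (Function.update lam i (4 * M.H / Ξ)) fun j => by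
    rcases eq_or_ne j i with rfl | hj
    · simp [hL]
    · simpa [hj] using hs.dual_mem j
  rw [Finset.sum_eq_single i (fun j _ hj => by simp [hj]) (by simp)] at h7
  simp only [Function.update_self] at h7
  have h8 := nonneg_of_mul_nonneg_right h7 (sub_pos.2 h6)
  simp only [dualGrad] at h8
  have h9 := mul_le_mul_of_nonneg_left (hs.dual_mem i).2 hτ
  linarith

/-! ### Multiplicative weights on a simplex -/

section Simplex

variable {ι : Type*} [Fintype ι] {p q Q : ι → ℝ} {η B : ℝ}

theorem sum_mul_exp_pos [Nonempty ι] (hq : ∀ i, 0 < q i) :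
    0 < ∑ i, q i * Real.exp (η * Q i) :=
  Finset.sum_pos (fun i _ => mul_pos (hq i) (Real.exp_pos _)) Finset.univ_nonempty

/-- Uses `exp x ≤ 1 + x + x²` for `0 ≤ x ≤ 1`, averaged over `q`, and then `log z ≤ z - 1`. -/
theorem log_sum_mul_exp_le [Nonempty ι] (hq : q ∈ stdSimplex ℝ ι) (hq' : ∀ i, 0 < q i)
    (hη : 0 ≤ η) (hQ : ∀ i, 0 ≤ Q i) (hQB : ∀ i, Q i ≤ B) (hB : η * B ≤ 1) :
    Real.log (∑ i, q i * Real.exp (η * Q i)) ≤ η * ∑ i, q i * Q i + η ^ 2 * B ^ 2 := by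
  have h1 : ∀ i, q i * Real.exp (η * Q i) ≤ q i * (1 + η * Q i + η ^ 2 * B ^ 2) := by
    intro i
    refine mul_le_mul_of_nonneg_left ?_ (hq' i).le
    have h2 : 0 ≤ η * Q i := mul_nonneg hη (hQ i)
    have h3 : η * Q i ≤ η * B := mul_le_mul_of_nonneg_left (hQB i) hη
    have h4 := Real.abs_exp_sub_one_sub_id_le (x := η * Q i) (by rw [abs_of_nonneg h2]; linarith)
    have h5 : (η * Q i) ^ 2 ≤ (η * B) ^ 2 := pow_le_pow_left₀ h2 h3 2
    linarith [(abs_le.1 h4).2, mul_pow η B 2]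
  have h2 := (Finset.sum_le_sum fun i (_ : i ∈ Finset.univ) => h1 i)
  have h3 : ∑ i, q i * (1 + η * Q i + η ^ 2 * B ^ 2) =
      1 + η * ∑ i, q i * Q i + η ^ 2 * B ^ 2 := by
    simp only [mul_add, mul_one, Finset.sum_add_distrib, ← Finset.sum_mul, hq.2, one_mul,
      mul_left_comm (q _) η, ← Finset.mul_sum]
  linarith [Real.log_le_sub_one_of_pos (sum_mul_exp_pos (η := η) (Q := Q) hq')]

theorem log_mul_exp_div [Nonempty ι] (hq : ∀ i, 0 < q i) (i : ι) :
    Real.log (q i * Real.exp (η * Q i) / ∑ j, q j * Real.exp (η * Q j)) =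
      Real.log (q i) + η * Q i - Real.log (∑ j, q j * Real.exp (η * Q j)) := by
  rw [Real.log_div (mul_pos (hq i) (Real.exp_pos _)).ne' (sum_mul_exp_pos hq).ne',
    Real.log_mul (hq i).ne' (Real.exp_pos _).ne', Real.log_exp]

/-- One step of multiplicative weights, measured by the relative entropy to `p`. -/
theorem kl_mul_exp_le [Nonempty ι] (hp : p ∈ stdSimplex ℝ ι) (hq : q ∈ stdSimplex ℝ ι)
    (hq' : ∀ i, 0 < q i) (hη : 0 ≤ η) (hQ : ∀ i, 0 ≤ Q i) (hQB : ∀ i, Q i ≤ B)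
    (hB : η * B ≤ 1) :
    ∑ i, p i * (Real.log (p i) -
        Real.log (q i * Real.exp (η * Q i) / ∑ j, q j * Real.exp (η * Q j))) ≤
      ∑ i, p i * (Real.log (p i) - Real.log (q i)) - η * ∑ i, (p i - q i) * Q i
        + η ^ 2 * B ^ 2 := by
  have h1 := log_sum_mul_exp_le hq hq' hη hQ hQB hB
  set Z := Real.log (∑ j, q j * Real.exp (η * Q j))
  have h2 : ∑ i, p i * (Real.log (p i) -
        Real.log (q i * Real.exp (η * Q i) / ∑ j, q j * Real.exp (η * Q j))) =
      ∑ i, p i * (Real.log (p i) - Real.log (q i)) - η * ∑ i, p i * Q i + Z := by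
    have : Z = ∑ i, p i * Z := by rw [← Finset.sum_mul, hp.2, one_mul]
    rw [this, Finset.mul_sum, ← Finset.sum_sub_distrib, ← Finset.sum_add_distrib]
    refine Finset.sum_congr rfl fun i _ => ?_
    rw [log_mul_exp_div hq']
    ring
  rw [h2]
  simp only [sub_mul, Finset.sum_sub_distrib]
  linarith

/-- A linearized form of Pinsker's inequality. -/
theorem sum_abs_sub_le_kl (hp : p ∈ stdSimplex ℝ ι) (hq : q ∈ stdSimplex ℝ ι)
    (hp' : ∀ i, 0 < p i) (hq' : ∀ i, 0 < q i) {δ : ℝ} (hδ : 0 < δ) :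
    ∑ i, |p i - q i| ≤ (∑ i, p i * (Real.log (p i) - Real.log (q i))) / δ + δ := by
  -- With `p = x²` and `q = y²`, the relative entropy dominates `(x - y)²` up to terms `q - p` that
  -- sum to zero, and `|p - q| = |x - y| (x + y)` is split by AM-GM with weight `δ`. Being linear in
  -- the relative entropy, the bound can later be averaged over states.
  have h1 : ∀ i, |p i - q i| ≤
      (p i * (Real.log (p i) - Real.log (q i)) + (q i - p i)) / δ + δ * ((p i + q i) / 2) := by
    intro i
    obtain ⟨x, hx, hxp⟩ : ∃ x : ℝ, 0 < x ∧ p i = x ^ 2 :=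
      ⟨√(p i), Real.sqrt_pos.2 (hp' i), (Real.sq_sqrt (hp' i).le).symm⟩
    obtain ⟨y, hy, hyq⟩ : ∃ y : ℝ, 0 < y ∧ q i = y ^ 2 :=
      ⟨√(q i), Real.sqrt_pos.2 (hq' i), (Real.sq_sqrt (hq' i).le).symm⟩
    rw [hxp, hyq, Real.log_pow, Real.log_pow]
    push_cast
    have h2 := Real.log_le_sub_one_of_pos (x := y / x) (by positivity)
    rw [Real.log_div hy.ne' hx.ne'] at h2
    have h3 : (x - y) ^ 2 ≤ x ^ 2 * (2 * Real.log x - 2 * Real.log y) + (y ^ 2 - x ^ 2) := by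
      have h4 := mul_le_mul_of_nonneg_left h2 (sq_nonneg x)
      have h5 : x ^ 2 * (y / x - 1) = x * y - x ^ 2 := by field_simp
      rw [h5] at h4
      nlinarith
    have h6 : |x ^ 2 - y ^ 2| = |x - y| * (x + y) := by
      rw [show x ^ 2 - y ^ 2 = (x - y) * (x + y) by ring, abs_mul, abs_of_pos (add_pos hx hy)]
    have h7 : |x - y| * (x + y) ≤ (x - y) ^ 2 / δ + δ * ((x ^ 2 + y ^ 2) / 2) := by
      have h8 : |x - y| * (x + y) ≤ (x - y) ^ 2 / δ + δ * ((x + y) ^ 2 / 4) := by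
        have h9 := sq_nonneg (|x - y| - δ * (x + y) / 2)
        have h10 : |x - y| * (x + y) * δ ≤ (x - y) ^ 2 + δ * δ * ((x + y) ^ 2 / 4) := by
          nlinarith [sq_abs (x - y)]
        calc |x - y| * (x + y) = |x - y| * (x + y) * δ / δ := by field_simp
          _ ≤ ((x - y) ^ 2 + δ * δ * ((x + y) ^ 2 / 4)) / δ := by gcongr
          _ = _ := by field_simp
      have h11 : δ * ((x + y) ^ 2 / 4) ≤ δ * ((x ^ 2 + y ^ 2) / 2) :=
        mul_le_mul_of_nonneg_left (by nlinarith [sq_nonneg (x - y)]) hδ.le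
      linarith
    rw [h6]
    refine h7.trans (add_le_add ?_ le_rfl)
    gcongr
  calc _ ≤ ∑ i, ((p i * (Real.log (p i) - Real.log (q i)) + (q i - p i)) / δ
          + δ * ((p i + q i) / 2)) := Finset.sum_le_sum fun i _ => h1 i
    _ = _ := by
      rw [Finset.sum_add_distrib, ← Finset.sum_div, Finset.sum_add_distrib,
        Finset.sum_sub_distrib, ← Finset.mul_sum, ← Finset.sum_div, Finset.sum_add_distrib,
        hp.2, hq.2]
      ring

end Simplex

/-! ### The composite action-value function -/

/-- The bound `H (1 + m L + log |A|)` on the composite value functions. -/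
def qBound (M : CMDP S A m) (L : ℝ) : ℝ := M.H * (1 + m * L + Real.log (Fintype.card A))

theorem sum_mul_le_card_mul {lam f : Fin m → ℝ} {L B : ℝ} (hlam : ∀ i, lam i ∈ Set.Icc 0 L)
    (hf : ∀ i, f i ∈ Set.Icc 0 B) : ∑ i, lam i * f i ≤ m * L * B := by
  calc ∑ i, lam i * f i ≤ ∑ _i : Fin m, L * B :=
        Finset.sum_le_sum fun i _ => mul_le_mul (hlam i).2 (hf i).2 (hf i).1
          ((hlam i).1.trans (hlam i).2)
    _ = _ := by simp [mul_assoc]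

/-- The entropy signal of the current action has no a priori bound, so it is kept on both sides;
`qBound` covers only the rest. -/
theorem compositeQ_mem [Nonempty A] {M : CMDP S A m} {τ L : ℝ} {π : ℕ → S → A → ℝ}
    {lam : Fin m → ℝ} (hτ : 0 ≤ τ) (hτ1 : τ ≤ 1) (hπ : M.IsPolicy π)
    (hlam : ∀ i, lam i ∈ Set.Icc 0 L) {h : ℕ} (hh : h < M.H) (s : S) (a : A) :
    M.compositeQ τ π lam h s a ∈ Set.Icc (τ * entropySignal π h s a)
      (M.qBound L + τ * entropySignal π h s a) := by
  have h1 := tpeQ_stepCap_mem hπ M.r_mem hh s a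
  have h2 := fun i => tpeQ_stepCap_mem hπ (M.d_mem i) hh s a
  have h3 := tpeQ_entropyCap_mem hπ hh s a
  have h4 := sum_mul_le_card_mul hlam h2
  have h5 : 0 ≤ ∑ i, lam i * M.tpeQ π (M.d i) stepCap h s a :=
    Finset.sum_nonneg fun i _ => mul_nonneg (hlam i).1 (h2 i).1
  have h6 := mul_le_mul_of_nonneg_left h3.1 hτ
  have h7 := mul_le_mul_of_nonneg_left h3.2 hτ
  have h8 : τ * (M.H * Real.log (Fintype.card A)) ≤ M.H * Real.log (Fintype.card A) :=
    mul_le_of_le_one_left (mul_nonneg (Nat.cast_nonneg _) (log_card_nonneg A)) hτ1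
  simp only [compositeQ, qBound]
  constructor
  · linarith [h1.1]
  · linarith [h1.2]

/-- Under the average over `π` the unbounded entropy signal becomes an entropy, which `qBound`
already covers. -/
theorem sum_mul_compositeQ_le [Nonempty A] {M : CMDP S A m} {τ L : ℝ} {π : ℕ → S → A → ℝ}
    {lam : Fin m → ℝ} (hτ1 : τ ≤ 1) (hπ : M.IsPolicy π)
    (hlam : ∀ i, lam i ∈ Set.Icc 0 L) {h : ℕ} (hh : h < M.H) (s : S) :
    ∑ a, π h s a * M.compositeQ τ π lam h s a ≤ M.qBound L := by
  have hle : ((M.H - h : ℕ) : ℝ) ≤ M.H := by exact_mod_cast Nat.sub_le _ _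
  have h1 := tpeV_stepCap_mem hπ M.r_mem (M.H - h) h (by omega) s
  have h2 := fun i => tpeV_stepCap_mem hπ (M.d_mem i) (M.H - h) h (by omega) s
  have h3 := tpeV_entropyCap_mem hπ (M.H - h) h (by omega) s
  have h4 := sum_mul_le_card_mul hlam (B := M.H) fun i => ⟨(h2 i).1, (h2 i).2.trans hle⟩
  have h5 : τ * M.tpeV π (entropySignal π) (entropyCap π) (M.H - h) h s ≤
      M.H * Real.log (Fintype.card A) :=
    (mul_le_of_le_one_left h3.1 hτ1).trans
      (h3.2.trans (mul_le_mul_of_nonneg_right hle (log_card_nonneg A)))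
  have h6 : ∑ a, π h s a * M.compositeQ τ π lam h s a =
      M.tpeV π M.r stepCap (M.H - h) h s + ∑ i, lam i * M.tpeV π (M.d i) stepCap (M.H - h) h s
        + τ * M.tpeV π (entropySignal π) (entropyCap π) (M.H - h) h s := by
    simp only [tpeV_eq_sum_tpeQ M π _ _ hh, compositeQ, mul_add, Finset.sum_add_distrib,
      Finset.mul_sum]
    rw [Finset.sum_comm]
    simp only [mul_left_comm]
  rw [h6, qBound]
  linarith [h1.2]

/-- The relative entropy of `π'` from `π`, along the trajectories of `π'`. -/
def klSum (M : CMDP S A m) (π' π : ℕ → S → A → ℝ) : ℝ :=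
  M.stateSum π' fun h s => ∑ a, π' h s a * (Real.log (π' h s a) - Real.log (π h s a))

/-- Performance difference for the entropy-regularized value. -/
theorem stateSum_compositeQ [Nonempty A] {M : CMDP S A m} {τ : ℝ} {π : ℕ → S → A → ℝ}
    (lam : Fin m → ℝ) (hπ : M.IsPolicy π) (π' : ℕ → S → A → ℝ) :
    (M.stateSum π' fun h s => ∑ a, (π' h s a - π h s a) * M.compositeQ τ π lam h s a) =
      M.regValue τ lam π' - M.regValue τ lam π + τ * M.klSum π' π := by
  have h1 := value_sub_value (isUntruncated_stepCap hπ M.r_mem) π'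
  have h2 := fun i => value_sub_value (isUntruncated_stepCap hπ (M.d_mem i)) π'
  have h3 := value_sub_value (isUntruncated_entropyCap (M := M) hπ) π'
  -- Cross entropy is entropy plus relative entropy. The relative entropy here is the strong
  -- concavity that produces the contraction.
  have h4 : M.value (entropySignal π) π' = M.value (entropySignal π') π' + M.klSum π' π := by
    rw [value_eq_stateSum, value_eq_stateSum, klSum, ← stateSum_add]
    refine stateSum_congr fun h _ s => ?_
    rw [← Finset.sum_add_distrib]
    refine Finset.sum_congr rfl fun a _ => ?_
    simp only [entropySignal]
    ring
  have h5 : (M.stateSum π' fun h s => ∑ a, (π' h s a - π h s a) * M.compositeQ τ π lam h s a) =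
      (M.value M.r π' - M.value M.r π) + ∑ i, lam i * (M.value (M.d i) π' - M.value (M.d i) π)
      + τ * (M.value (entropySignal π) π' - M.value (entropySignal π) π) := by
    have h6 : ∀ i, lam i * (M.value (M.d i) π' - M.value (M.d i) π) = M.stateSum π' fun h s =>
        lam i * ∑ a, (π' h s a - π h s a) * M.tpeQ π (M.d i) stepCap h s a := fun i => by
      rw [h2 i, stateSum_const_mul]
    have h7 : ∑ i, lam i * (M.value (M.d i) π' - M.value (M.d i) π) = M.stateSum π' fun h s =>
        ∑ i, lam i * ∑ a, (π' h s a - π h s a) * M.tpeQ π (M.d i) stepCap h s a := by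
      simp only [h6, stateSum, Finset.mul_sum]
      rw [Finset.sum_comm]
      refine Finset.sum_congr rfl fun h _ => ?_
      rw [Finset.sum_comm]
    rw [h1, h3, h7, ← stateSum_const_mul, ← stateSum_add, ← stateSum_add]
    refine stateSum_congr fun h _ s => ?_
    simp only [compositeQ, mul_add, Finset.sum_add_distrib, Finset.mul_sum]
    rw [Finset.sum_comm]
    simp only [mul_left_comm]
  rw [h5, h4, regValue_eq, regValue_eq]
  simp only [mul_sub, Finset.sum_sub_distrib]
  ring

/-! ### One step of the algorithm -/

/-- The invariant of the iterates. -/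
structure IsAdmissible (M : CMDP S A m) (τ L : ℝ) (π : ℕ → S → A → ℝ) (lam : Fin m → ℝ) :
    Prop where
  isPolicy : M.IsPolicy π
  isPosPolicy : M.IsPosPolicy π
  dual_mem : ∀ i, lam i ∈ Set.Icc 0 L
  entropy_le : ∀ h < M.H, ∀ s a, τ * entropySignal π h s a ≤ M.qBound L + 1

theorem qBound_nonneg {M : CMDP S A m} {L : ℝ} (hL : 0 ≤ L) : 0 ≤ M.qBound L := by
  have := log_card_nonneg A
  unfold qBound
  positivity

theorem IsAdmissible.compositeQ_mem [Nonempty A] {M : CMDP S A m} {τ L : ℝ}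
    {π : ℕ → S → A → ℝ} {lam : Fin m → ℝ} (ha : M.IsAdmissible τ L π lam) (hτ : 0 ≤ τ)
    (hτ1 : τ ≤ 1) {h : ℕ} (hh : h < M.H) (s : S) (a : A) :
    M.compositeQ τ π lam h s a ∈ Set.Icc 0 (2 * M.qBound L + 1) := by
  have h1 := CMDP.compositeQ_mem hτ hτ1 ha.isPolicy ha.dual_mem hh s a
  have h2 := mul_nonneg hτ (entropySignal_nonneg ha.isPolicy hh s a)
  exact ⟨h2.trans h1.1, by linarith [h1.2, ha.entropy_le h hh s a]⟩

theorem policyUpdate_isPosPolicy [Nonempty A] {M : CMDP S A m} {π : ℕ → S → A → ℝ}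
    (hπ : M.IsPosPolicy π) (η τ : ℝ) (lam : Fin m → ℝ) :
    M.IsPosPolicy (M.policyUpdate η τ π lam) := fun h hh s a =>
  div_pos (mul_pos (hπ h hh s a) (Real.exp_pos _)) (sum_mul_exp_pos (hπ h hh s))

theorem policyUpdate_isPolicy [Nonempty A] {M : CMDP S A m} {π : ℕ → S → A → ℝ}
    (hπ : M.IsPosPolicy π) (η τ : ℝ) (lam : Fin m → ℝ) :
    M.IsPolicy (M.policyUpdate η τ π lam) := fun h hh s =>
  ⟨fun a => (policyUpdate_isPosPolicy hπ η τ lam h hh s a).le, by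
    simp only [policyUpdate, ← Finset.sum_div]
    exact div_self (sum_mul_exp_pos (hπ h hh s)).ne'⟩

theorem mul_le_one_of_mul_sq_le_one {η B : ℝ} (hη : 0 ≤ η) (hB : 1 ≤ B) (h : η * B ^ 2 ≤ 1) :
    η * B ≤ 1 :=
  (mul_le_mul_of_nonneg_left (by nlinarith) hη).trans h

/-- The entropy bound is self-correcting. Since `Q ≥ τψ` and the log-normalizer is at most `η
(qBound + 1)`, the new signal is at most `(1 - ητ) ψ + η (qBound + 1)`; after multiplication by `τ`
this is a convex combination of quantities bounded by `qBound + 1`. -/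
theorem IsAdmissible.update [Nonempty A] {M : CMDP S A m} {τ L : ℝ}
    {π : ℕ → S → A → ℝ} {lam : Fin m → ℝ} (ha : M.IsAdmissible τ L π lam) (hτ : 0 ≤ τ)
    (hτ1 : τ ≤ 1) {Ξ : ℝ} (hL : L = 4 * M.H / Ξ) (hL0 : 0 ≤ L) {η : ℝ} (hη : 0 ≤ η)
    (hηB : η * (2 * M.qBound L + 1) ^ 2 ≤ 1) (marg : Fin m → ℝ) :
    M.IsAdmissible τ L (M.policyUpdate η τ π lam) (M.dualUpdate Ξ η τ marg π lam) := by
  have hB0 : 0 ≤ M.qBound L := qBound_nonneg hL0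
  have hηB1 := mul_le_one_of_mul_sq_le_one hη (by linarith) hηB
  refine ⟨policyUpdate_isPolicy ha.isPosPolicy η τ lam,
    policyUpdate_isPosPolicy ha.isPosPolicy η τ lam, fun i => ⟨le_max_left _ _, ?_⟩, ?_⟩
  · rw [dualUpdate, ← hL]
    exact max_le hL0 (min_le_left _ _)
  · intro h hh s a
    have h1 := log_sum_mul_exp_le (ha.isPolicy h hh s) (ha.isPosPolicy h hh s) hη
      (fun a => (ha.compositeQ_mem hτ hτ1 hh s a).1)
      (fun a => (ha.compositeQ_mem hτ hτ1 hh s a).2) hηB1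
    have h2 := mul_le_mul_of_nonneg_left
      (sum_mul_compositeQ_le hτ1 ha.isPolicy ha.dual_mem hh s) hη
    have h3 := (CMDP.compositeQ_mem hτ hτ1 ha.isPolicy ha.dual_mem hh s a).1
    have h4 := ha.entropy_le h hh s a
    have h5 : entropySignal (M.policyUpdate η τ π lam) h s a ≤
        (1 - η * τ) * entropySignal π h s a + η * (M.qBound L + 1) := by
      have h6 : η ^ 2 * (2 * M.qBound L + 1) ^ 2 ≤ η := by
        calc _ = η * (η * (2 * M.qBound L + 1) ^ 2) := by ring
          _ ≤ η * 1 := mul_le_mul_of_nonneg_left hηB hη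
          _ = η := mul_one _
      have h7 := mul_le_mul_of_nonneg_left h3 hη
      have h8 := log_mul_exp_div (η := η) (Q := M.compositeQ τ π lam h s) (ha.isPosPolicy h hh s) a
      have h9 : entropySignal (M.policyUpdate η τ π lam) h s a =
        entropySignal π h s a - η * M.compositeQ τ π lam h s a +
          Real.log (∑ b, π h s b * Real.exp (η * M.compositeQ τ π lam h s b)) := by
        simp only [entropySignal, policyUpdate]
        rw [h8]
        ring
      rw [h9]
      linarith
    have h6 : η * τ ≤ 1 := by
      have : η * τ ≤ η * (2 * M.qBound L + 1) := mul_le_mul_of_nonneg_left (by linarith) hη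
      linarith
    have h7 := mul_le_mul_of_nonneg_left h5 hτ
    have h8 := mul_le_mul_of_nonneg_left h4 (sub_nonneg.2 h6)
    linarith

/-- The one-step estimate of multiplicative weights, averaged over the states visited by `π'`. The
factor `1 - ητ` comes from the relative entropy in `stateSum_compositeQ`. -/
theorem klSum_policyUpdate_le [Nonempty A] {M : CMDP S A m} {τ L : ℝ}
    {π : ℕ → S → A → ℝ} {lam : Fin m → ℝ} (ha : M.IsAdmissible τ L π lam) (hτ : 0 ≤ τ)
    (hτ1 : τ ≤ 1) (hL : 0 ≤ L) {η : ℝ} (hη : 0 ≤ η)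
    (hηB : η * (2 * M.qBound L + 1) ^ 2 ≤ 1) {π' : ℕ → S → A → ℝ} (hπ' : M.IsPolicy π') :
    M.klSum π' (M.policyUpdate η τ π lam) ≤ (1 - η * τ) * M.klSum π' π
      - η * (M.regValue τ lam π' - M.regValue τ lam π)
      + η ^ 2 * (M.H * (2 * M.qBound L + 1) ^ 2) := by
  have hB0 : 0 ≤ M.qBound L := qBound_nonneg hL
  have hηB1 := mul_le_one_of_mul_sq_le_one hη (by linarith) hηB
  have h1 := stateSum_mono hπ' fun h hh s => kl_mul_exp_le (hπ' h hh s) (ha.isPolicy h hh s)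
    (ha.isPosPolicy h hh s) hη (fun a => (ha.compositeQ_mem hτ hτ1 hh s a).1)
      (fun a => (ha.compositeQ_mem hτ hτ1 hh s a).2) hηB1
  rw [stateSum_add, stateSum_sub, stateSum_const_mul, stateSum_const hπ',
    stateSum_compositeQ lam ha.isPolicy] at h1
  change M.klSum π' (M.policyUpdate η τ π lam) ≤ M.klSum π' π - _ + _ at h1
  linarith

theorem sq_clip_sub_le {L x y : ℝ} (hy : y ∈ Set.Icc 0 L) :
    (max 0 (min L x) - y) ^ 2 ≤ (x - y) ^ 2 := by
  refine sq_le_sq.2 ?_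
  have h1 := abs_max_sub_max_le_max 0 (min L x) 0 (min L y)
  have h2 := abs_min_sub_min_le_max L x L y
  rw [min_eq_right hy.2, max_eq_right hy.1, sub_self, abs_zero,
    max_eq_right (abs_nonneg (min L x - y))] at h1
  rw [min_eq_right hy.2, sub_self, abs_zero, max_eq_right (abs_nonneg _)] at h2
  exact h1.trans h2

/-- Without active truncation the update is a projected gradient step along `dualGrad` for the
thresholds `α + marg`. Clipping does not increase the distance to a point of the box, and each
partial derivative is at most `H + 1 + L` in absolute value. -/
theorem sum_sq_dualUpdate_sub_le {M : CMDP S A m} {τ L : ℝ} {π : ℕ → S → A → ℝ}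
    {lam : Fin m → ℝ} (ha : M.IsAdmissible τ L π lam) (hτ : 0 ≤ τ) (hτ1 : τ ≤ 1) {Ξ : ℝ}
    (hL : L = 4 * M.H / Ξ) (η : ℝ) {marg : Fin m → ℝ} (hmarg : ∀ i, marg i ∈ Set.Icc (0 : ℝ) 1)
    {mu : Fin m → ℝ} (hmu : ∀ i, mu i ∈ Set.Icc 0 L) :
    ∑ i, (M.dualUpdate Ξ η τ marg π lam i - mu i) ^ 2 ≤ ∑ i, (lam i - mu i) ^ 2
      + 2 * η * ∑ i, (mu i - lam i) * M.dualGrad τ (fun i => M.α i + marg i) lam π i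
      + η ^ 2 * (m * (M.H + 1 + L) ^ 2) := by
  have key : ∀ i, (M.dualUpdate Ξ η τ marg π lam i - mu i) ^ 2 ≤ (lam i - mu i) ^ 2
      + 2 * η * ((mu i - lam i) * M.dualGrad τ (fun i => M.α i + marg i) lam π i)
      + η ^ 2 * (M.H + 1 + L) ^ 2 := by
    intro i
    have h1 := sq_clip_sub_le (x := (1 - η * τ) * lam i - η *
      (M.tpeV π (M.d i) stepCap M.H 0 M.s₁ - marg i - M.α i)) (hmu i)
    rw [tpeV_eq_value (isUntruncated_stepCap ha.isPolicy (M.d_mem i))] at h1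
    have h2 : M.value (M.d i) π ≤ M.H :=
      value_le ha.isPolicy fun h hh s a => (M.d_mem i h hh s a).2
    have h3 : 0 ≤ M.value (M.d i) π :=
      value_nonneg ha.isPolicy fun h hh s a => (M.d_mem i h hh s a).1
    have h4 : τ * lam i ≤ L := (mul_le_of_le_one_left (ha.dual_mem i).1 hτ1).trans (ha.dual_mem i).2
    have h5 : 0 ≤ τ * lam i := mul_nonneg hτ (ha.dual_mem i).1
    have h6 : (M.dualGrad τ (fun i => M.α i + marg i) lam π i) ^ 2 ≤ (M.H + 1 + L) ^ 2 := by
      refine sq_le_sq' ?_ ?_ <;> simp only [dualGrad]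
      · linarith [(M.α_mem i).2, (hmarg i).2]
      · linarith [(M.α_mem i).1, (hmarg i).1]
    have h7 := mul_le_mul_of_nonneg_left h6 (sq_nonneg η)
    rw [dualUpdate, ← hL, tpeV_eq_value (isUntruncated_stepCap ha.isPolicy (M.d_mem i))]
    refine h1.trans (le_of_eq_of_le ?_ (add_le_add le_rfl h7))
    simp only [dualGrad]
    ring
  refine (Finset.sum_le_sum fun i _ => key i).trans (le_of_eq ?_)
  rw [Finset.sum_add_distrib, Finset.sum_add_distrib, ← Finset.mul_sum]
  simp
  ring

/-- The distance of a primal-dual pair to a reference pair. -/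
def potential (M : CMDP S A m) (π' : ℕ → S → A → ℝ) (mu : Fin m → ℝ) (π : ℕ → S → A → ℝ)
    (lam : Fin m → ℝ) : ℝ :=
  M.klSum π' π + 1 / 2 * ∑ i, (lam i - mu i) ^ 2

/-- The error of one step of the algorithm is `η²` times this constant. -/
def stepError (M : CMDP S A m) (L : ℝ) : ℝ :=
  M.H * (2 * M.qBound L + 1) ^ 2 + m * (M.H + 1 + L) ^ 2 / 2

/-- The potential with respect to a saddle point contracts, up to a second-order error. -/
theorem potential_update_le [Nonempty A] {M : CMDP S A m} {τ L : ℝ}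
    {π : ℕ → S → A → ℝ} {lam : Fin m → ℝ} (ha : M.IsAdmissible τ L π lam) (hτ : 0 ≤ τ)
    (hτ1 : τ ≤ 1) {Ξ : ℝ} (hL : L = 4 * M.H / Ξ) (hL0 : 0 ≤ L) {η : ℝ} (hη : 0 ≤ η)
    (hηB : η * (2 * M.qBound L + 1) ^ 2 ≤ 1) {marg : Fin m → ℝ}
    (hmarg : ∀ i, marg i ∈ Set.Icc (0 : ℝ) 1) {π' : ℕ → S → A → ℝ} {mu : Fin m → ℝ}
    (hs : M.IsSaddle τ (fun i => M.α i + marg i) L π' mu) :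
    M.potential π' mu (M.policyUpdate η τ π lam) (M.dualUpdate Ξ η τ marg π lam) ≤
      (1 - η * τ) * M.potential π' mu π lam + η ^ 2 * M.stepError L := by
  have h1 := klSum_policyUpdate_le ha hτ hτ1 hL0 hη hηB hs.isPolicy
  have h2 := sum_sq_dualUpdate_sub_le ha hτ hτ1 hL η hmarg hs.dual_mem
  have h3 := lagrangian_eq_add M τ (fun i => M.α i + marg i) lam mu π
  have h4 := hs.primal_opt π ha.isPolicy
  have h5 := hs.le_lagrangian hτ ha.dual_mem
  have h6 : M.lagrangian τ (fun i => M.α i + marg i) lam π' -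
      M.lagrangian τ (fun i => M.α i + marg i) lam π =
      M.regValue τ lam π' - M.regValue τ lam π := by
    simp only [lagrangian]
    ring
  have h7 : ∑ i, (mu i - lam i) ^ 2 = ∑ i, (lam i - mu i) ^ 2 :=
    Finset.sum_congr rfl fun i _ => by ring
  rw [h7] at h3
  -- The saddle inequalities give `L(mu, π) ≤ L(mu, π') ≤ L(lam, π')` for the Lagrangian `L`;
  -- expanding the left end around `lam` leaves the quadratic term that contracts the dual distance.
  have h8 : η * (∑ i, (mu i - lam i) * M.dualGrad τ (fun i => M.α i + marg i) lam π i
      + τ / 2 * ∑ i, (lam i - mu i) ^ 2) ≤ η * (M.regValue τ lam π' - M.regValue τ lam π) :=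
    mul_le_mul_of_nonneg_left (by linarith) hη
  simp only [potential, stepError]
  linarith

/-! ### From the relative entropy to values -/

/-- Performance difference with action values in `[0, H]` leaves the `ℓ¹` distance of the policies
at each state. The free parameter `δ` is later set to `ε`, matching a relative entropy of order
`ε²`. -/
theorem abs_value_sub_value_le {M : CMDP S A m} {π π' v : ℕ → S → A → ℝ} (hπ : M.IsPolicy π)
    (hπp : M.IsPosPolicy π) (hπ' : M.IsPolicy π') (hπp' : M.IsPosPolicy π')
    (hv : ∀ h < M.H, ∀ s a, v h s a ∈ Set.Icc (0 : ℝ) 1) {δ : ℝ} (hδ : 0 < δ) :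
    |M.value v π' - M.value v π| ≤ M.H * (M.klSum π' π / δ + M.H * δ) := by
  have key : ∀ h < M.H, ∀ s, |∑ a, (π' h s a - π h s a) * M.tpeQ π v stepCap h s a| ≤
      M.H * (δ⁻¹ * ∑ a, π' h s a * (Real.log (π' h s a) - Real.log (π h s a)) + δ) := by
    intro h hh s
    refine (Finset.abs_sum_le_sum_abs _ _).trans ?_
    have h1 := sum_abs_sub_le_kl (hπ' h hh s) (hπ h hh s) (hπp' h hh s) (hπp h hh s) hδ
    rw [div_eq_inv_mul] at h1
    refine le_trans ?_ (mul_le_mul_of_nonneg_left h1 (Nat.cast_nonneg _))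
    rw [Finset.mul_sum]
    refine Finset.sum_le_sum fun a _ => ?_
    have h2 := tpeQ_stepCap_mem hπ hv hh s a
    rw [abs_mul, abs_of_nonneg h2.1, mul_comm]
    exact mul_le_mul_of_nonneg_right h2.2 (abs_nonneg _)
  have h1 := stateSum_mono hπ' fun h hh s => (abs_le.1 (key h hh s)).2
  have h2 := stateSum_mono hπ' fun h hh s => neg_le.1 (abs_le.1 (key h hh s)).1
  have h3 : (M.stateSum π' fun h s => -∑ a, (π' h s a - π h s a) * M.tpeQ π v stepCap h s a) =
      -M.stateSum π' fun h s => ∑ a, (π' h s a - π h s a) * M.tpeQ π v stepCap h s a := by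
    simp only [stateSum, mul_neg, Finset.sum_neg_distrib]
  rw [h3] at h2
  rw [stateSum_const_mul, stateSum_add, stateSum_const_mul, stateSum_const hπ',
    ← value_sub_value (isUntruncated_stepCap hπ hv)] at h1 h2
  rw [div_eq_inv_mul]
  exact abs_le.2 ⟨neg_le.1 h2, h1⟩

/-! ### The iterates -/

theorem uniform_mem_stdSimplex (A : Type*) [Fintype A] [Nonempty A] :
    (fun _ => 1 / (Fintype.card A : ℝ)) ∈ stdSimplex ℝ A :=
  ⟨fun _ => by positivity, by
    have : (Fintype.card A : ℝ) ≠ 0 := by exact_mod_cast Fintype.card_ne_zero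
    simp [this]⟩

theorem isAdmissible_init [Nonempty A] {M : CMDP S A m} {τ L : ℝ} (hτ1 : τ ≤ 1)
    (hL : 0 ≤ L) (hH : 0 < M.H) :
    M.IsAdmissible τ L (fun _ _ _ => 1 / (Fintype.card A : ℝ)) (fun _ => 0) := by
  have hl := log_card_nonneg A
  refine ⟨fun _ _ _ => uniform_mem_stdSimplex A, fun _ _ _ _ => ?_, fun _ => ⟨le_rfl, hL⟩,
    fun _ _ _ _ => ?_⟩
  · have : (0 : ℝ) < Fintype.card A := by exact_mod_cast Fintype.card_pos
    positivity
  · have h1 : (1 : ℝ) ≤ M.H := by exact_mod_cast hH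
    simp only [entropySignal, one_div, Real.log_inv, neg_neg, qBound]
    have h2 : 0 ≤ m * L := by positivity
    nlinarith

theorem potential_init_le [Nonempty A] {M : CMDP S A m} {L : ℝ} {π' : ℕ → S → A → ℝ}
    {mu : Fin m → ℝ} (hπ' : M.IsPolicy π') (hmu : ∀ i, mu i ∈ Set.Icc 0 L) :
    M.potential π' mu (fun _ _ _ => 1 / (Fintype.card A : ℝ)) (fun _ => 0) ≤
      M.H * Real.log (Fintype.card A) + m * L ^ 2 := by
  have h1 : M.klSum π' (fun _ _ _ => 1 / (Fintype.card A : ℝ)) ≤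
      M.H * Real.log (Fintype.card A) := by
    rw [← stateSum_const hπ', klSum]
    refine stateSum_mono hπ' fun h hh s => ?_
    have := entropy_nonneg (hπ' h hh s)
    simp only [mul_neg, Finset.sum_neg_distrib] at this
    simp only [one_div, Real.log_inv, sub_neg_eq_add, mul_add, Finset.sum_add_distrib,
      ← Finset.sum_mul, (hπ' h hh s).2, one_mul]
    linarith
  have h2 : ∑ i, (0 - mu i) ^ 2 ≤ m * L ^ 2 := by
    calc ∑ i, (0 - mu i) ^ 2 ≤ ∑ _i : Fin m, L ^ 2 := Finset.sum_le_sum fun i _ => by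
          nlinarith [(hmu i).1, (hmu i).2]
      _ = _ := by simp
  have h3 : 0 ≤ ∑ i, (0 - mu i) ^ 2 := Finset.sum_nonneg fun i _ => sq_nonneg _
  simp only [potential]
  linarith

theorem isAdmissible_flexIterate [Nonempty A] {M : CMDP S A m} {τ L Ξ : ℝ} (hτ : 0 ≤ τ)
    (hτ1 : τ ≤ 1) (hL : L = 4 * M.H / Ξ) (hL0 : 0 ≤ L) (hH : 0 < M.H) {η : ℕ → ℝ}
    (hη : ∀ t, 1 ≤ t → 0 ≤ η t) (hηB : ∀ t, 1 ≤ t → η t * (2 * M.qBound L + 1) ^ 2 ≤ 1)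
    (marg : Fin m → ℝ) (n : ℕ) :
    M.IsAdmissible τ L (M.flexIterate Ξ η (fun _ => τ) (fun _ => marg) n).1
      (M.flexIterate Ξ η (fun _ => τ) (fun _ => marg) n).2 := by
  induction n with
  | zero => exact isAdmissible_init hτ1 hL0 hH
  | succ n ih => exact ih.update hτ hτ1 hL hL0 (hη _ (by omega)) (hηB _ (by omega)) marg

/-- A contraction with rate at least `ρ` and error at most `rate * e`. -/
theorem le_pow_mul_add_of_contraction {x θ : ℕ → ℝ} {ρ e X : ℝ} (hX : 0 ≤ X)
    (hρ : ∀ n, ρ ≤ θ n) (hθ : ∀ n, θ n ≤ 1) (h0 : x 0 ≤ X) (he : 0 ≤ e)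
    (hx : ∀ n, x (n + 1) ≤ (1 - θ n) * x n + θ n * e) (n : ℕ) :
    x n ≤ (1 - ρ) ^ n * X + e := by
  have hρ1 : 0 ≤ 1 - ρ := by linarith [hρ 0, hθ 0]
  induction n with
  | zero => simp only [pow_zero, one_mul]; linarith
  | succ n ih =>
    have h1 := mul_le_mul_of_nonneg_left ih (sub_nonneg.2 (hθ n))
    have h2 : (1 - θ n) * ((1 - ρ) ^ n * X) ≤ (1 - ρ) * ((1 - ρ) ^ n * X) :=
      mul_le_mul_of_nonneg_right (by linarith [hρ n]) (by positivity)
    rw [pow_succ]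
    linarith [hx n]

/-- From `1 - x ≤ exp (-x)`. The exponent is `t - 1` because episode `t` is entry `t - 1` of the
iteration; the missing step costs a factor `exp (c ε⁴) ≤ e < 3`. -/
theorem one_sub_pow_le_sq {c ε : ℝ} (hc : 0 < c) (hε : 0 < ε) (hcε : c * ε ^ 4 ≤ 1) {t : ℕ}
    (ht1 : 1 ≤ t) (ht : 2 / c * (ε ^ 4)⁻¹ * Real.log (1 / ε) ≤ t) :
    (1 - c * ε ^ 4) ^ (t - 1) ≤ 3 * ε ^ 2 := by
  have h1 : 1 - c * ε ^ 4 ≤ Real.exp (-(c * ε ^ 4)) := by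
    linarith [Real.add_one_le_exp (-(c * ε ^ 4))]
  have h2 : (2 : ℝ) * Real.log (1 / ε) ≤ c * ε ^ 4 * t := by
    have := mul_le_mul_of_nonneg_left ht (by positivity : 0 ≤ c * ε ^ 4)
    refine le_trans (le_of_eq ?_) this
    field_simp
  calc (1 - c * ε ^ 4) ^ (t - 1) ≤ Real.exp (-(c * ε ^ 4)) ^ (t - 1) :=
        pow_le_pow_left₀ (by linarith) h1 _
    _ = Real.exp ((t - 1 : ℕ) * -(c * ε ^ 4)) := (Real.exp_nat_mul _ _).symm
    _ ≤ Real.exp (1 + 2 * Real.log ε) := by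
        refine Real.exp_le_exp.2 ?_
        rw [Nat.cast_sub ht1]
        rw [one_div, Real.log_inv] at h2
        push_cast
        linarith
    _ = Real.exp 1 * ε ^ 2 := by
        rw [Real.exp_add, mul_comm (2 : ℝ), Real.exp_mul, Real.exp_log hε]
        norm_num
    _ ≤ 3 * ε ^ 2 := mul_le_mul_of_nonneg_right Real.exp_one_lt_three.le (sq_nonneg _)

/-! ### Consequences of Slater's condition -/

theorem IsSlater.slaterGap_le {M : CMDP S A m} {π₀ : ℕ → S → A → ℝ} {d₀ : Fin m → ℝ}
    (hs : M.IsSlater π₀ d₀) (i : Fin m) :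
    M.slaterGap d₀ ≤ M.value (M.d i) π₀ - M.α i :=
  (ciInf_le (Set.finite_range _).bddBelow i).trans (sub_le_sub_right (hs.2 i).1 _)

theorem IsSlater.slaterGap_pos {M : CMDP S A m} {π₀ : ℕ → S → A → ℝ} {d₀ : Fin m → ℝ}
    (hs : M.IsSlater π₀ d₀) (hm : 0 < m) : 0 < M.slaterGap d₀ := by
  have : Nonempty (Fin m) := ⟨⟨0, hm⟩⟩
  obtain ⟨i, hi⟩ := exists_eq_ciInf_of_finite (f := fun i => d₀ i - M.α i)
  rw [slaterGap, ← hi]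
  exact sub_pos.2 (hs.2 i).2

/-- Slater's condition makes a constraint value exceed a nonnegative threshold strictly, whereas no
value exceeds `H`. -/
theorem IsSlater.horizon_pos {M : CMDP S A m} {π₀ : ℕ → S → A → ℝ} {d₀ : Fin m → ℝ}
    (hs : M.IsSlater π₀ d₀) (hm : 0 < m) : 0 < M.H := by
  have h1 := hs.slaterGap_le ⟨0, hm⟩
  have h2 := hs.slaterGap_pos hm
  have h3 : M.value (M.d ⟨0, hm⟩) π₀ ≤ M.H :=
    value_le hs.1 fun h hh s a => (M.d_mem _ h hh s a).2
  have : (0 : ℝ) < M.H := by linarith [(M.α_mem ⟨0, hm⟩).1]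
  exact_mod_cast this

theorem IsSlater.nonempty {M : CMDP S A m} {π₀ : ℕ → S → A → ℝ} {d₀ : Fin m → ℝ}
    (hs : M.IsSlater π₀ d₀) (hm : 0 < m) : Nonempty A := by
  by_contra hA
  rw [not_nonempty_iff] at hA
  have := (hs.1 0 (hs.horizon_pos hm) M.s₁).2
  simp at this

/-! ### Last-iterate convergence -/

/-- After `Ω(ε⁻⁴ log (1/ε))` steps the potential of the iterates is of order `ε²`. -/
theorem klSum_flexPolicy_le [Nonempty A] {M : CMDP S A m} {τ L Ξ : ℝ}
    (hL : L = 4 * M.H / Ξ) (hL0 : 0 ≤ L) (hH : 0 < M.H) {cη cη' cτ : ℝ} (hcη : 0 < cη)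
    (hcη' : cη ≤ cη') (hcτ : 0 < cτ) {ε : ℝ} (hε : 0 < ε) (hτ : cτ * ε ≤ τ) (hτ1 : τ ≤ 1)
    {η : ℕ → ℝ} (hη : ∀ t, 1 ≤ t → cη * ε ^ 3 ≤ η t ∧ η t ≤ cη' * ε ^ 3)
    (hηB : cη' * ε ^ 3 * (2 * M.qBound L + 1) ^ 2 ≤ 1) {marg : Fin m → ℝ}
    (hmarg : ∀ i, marg i ∈ Set.Icc (0 : ℝ) 1) {π' : ℕ → S → A → ℝ} {mu : Fin m → ℝ}
    (hs : M.IsSaddle τ (fun i => M.α i + marg i) L π' mu) {t : ℕ} (ht1 : 1 ≤ t)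
    (ht : 2 / (cη * cτ) * (ε ^ 4)⁻¹ * Real.log (1 / ε) ≤ t) :
    M.klSum π' (M.flexPolicy Ξ η (fun _ => τ) (fun _ => marg) t) ≤
      (3 * (M.H * Real.log (Fintype.card A) + m * L ^ 2) + cη' * M.stepError L / cτ) * ε ^ 2 := by
  have hB := qBound_nonneg (M := M) hL0
  have hl := log_card_nonneg A
  have hτ0 : 0 < τ := lt_of_lt_of_le (by positivity) hτ
  have hE : 0 ≤ M.stepError L := by unfold stepError; positivity
  have hη0 : ∀ t, 1 ≤ t → 0 ≤ η t := fun t ht => le_trans (by positivity) (hη t ht).1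
  have hηB' : ∀ t, 1 ≤ t → η t * (2 * M.qBound L + 1) ^ 2 ≤ 1 := fun t ht =>
    (mul_le_mul_of_nonneg_right (hη t ht).2 (sq_nonneg _)).trans hηB
  have hη1 : ∀ t, 1 ≤ t → η t ≤ 1 := fun t ht =>
    (le_mul_of_one_le_right (hη0 t ht) (by nlinarith)).trans (hηB' t ht)
  have hadm := isAdmissible_flexIterate hτ0.le hτ1 hL hL0 hH hη0 hηB' marg
  have hρ : ∀ n, cη * cτ * ε ^ 4 ≤ η (n + 1) * τ := fun n => by
    calc cη * cτ * ε ^ 4 = cη * ε ^ 3 * (cτ * ε) := by ring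
      _ ≤ η (n + 1) * τ := mul_le_mul (hη _ (by omega)).1 hτ (by positivity) (hη0 _ (by omega))
  have hθ : ∀ n, η (n + 1) * τ ≤ 1 := fun n =>
    mul_le_one₀ (hη1 _ (by omega)) hτ0.le hτ1
  have hcη'0 : 0 < cη' := hcη.trans_le hcη'
  have hcon := le_pow_mul_add_of_contraction
    (x := fun n => M.potential π' mu (M.flexIterate Ξ η (fun _ => τ) (fun _ => marg) n).1
      (M.flexIterate Ξ η (fun _ => τ) (fun _ => marg) n).2)
    (θ := fun n => η (n + 1) * τ) (ρ := cη * cτ * ε ^ 4)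
    (X := M.H * Real.log (Fintype.card A) + m * L ^ 2)
    (e := cη' * M.stepError L / cτ * ε ^ 2) (by positivity) hρ hθ
    (potential_init_le hs.isPolicy hs.dual_mem) (by positivity) (fun n => by
      refine (potential_update_le (hadm n) hτ0.le hτ1 hL hL0 (hη0 (n + 1) (by omega))
        (hηB' (n + 1) (by omega)) hmarg hs).trans (add_le_add le_rfl ?_)
      -- The error `η² E` is written as the rate `ητ` times `ηE/τ`, and `η/τ ≤ (cη'/cτ) ε²`.
      have h1 : η (n + 1) * M.stepError L ≤ τ * (cη' * M.stepError L / cτ * ε ^ 2) := by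
        calc η (n + 1) * M.stepError L ≤ cη' * ε ^ 3 * M.stepError L :=
              mul_le_mul_of_nonneg_right (hη _ (by omega)).2 hE
          _ = cτ * ε * (cη' * M.stepError L / cτ * ε ^ 2) := by field_simp
          _ ≤ _ := mul_le_mul_of_nonneg_right hτ (by positivity)
      have h2 := mul_le_mul_of_nonneg_left h1 (hη0 (n + 1) (by omega))
      linarith) (t - 1)
  have hpow := mul_le_mul_of_nonneg_right
    (one_sub_pow_le_sq (c := cη * cτ) (by positivity) hε ((hρ 0).trans (hθ 0)) ht1 ht)
    (by positivity : 0 ≤ M.H * Real.log (Fintype.card A) + m * L ^ 2)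
  have hkl : M.klSum π' (M.flexPolicy Ξ η (fun _ => τ) (fun _ => marg) t) ≤
      M.potential π' mu (M.flexIterate Ξ η (fun _ => τ) (fun _ => marg) (t - 1)).1
      (M.flexIterate Ξ η (fun _ => τ) (fun _ => marg) (t - 1)).2 :=
    le_add_of_nonneg_right (mul_nonneg (by norm_num) (Finset.sum_nonneg fun i _ => sq_nonneg _))
  linarith

end
end CMDP

theorem theorem2 {S A : Type*} [Fintype S] [Fintype A] [DecidableEq S] {m : ℕ} (hm : 0 < m)
    (M : CMDP S A m) (π₀ : ℕ → S → A → ℝ) (d₀ : Fin m → ℝ) (hSlater : M.IsSlater π₀ d₀)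
    -- constants hidden in `η_t = Θ(ε³)` and `τ = Θ(ε)`
    (cη cη' cτ cτ' : ℝ) (hcη : 0 < cη) (hcη' : cη ≤ cη') (hcτ : 0 < cτ) (hcτ' : cτ ≤ cτ') :
    -- constant of `t = Ω(ε⁻⁴ log(1/ε))`, and lower bound for the constant of the margins
    ∃ K > 0, ∃ C₀ > 0,
      -- constants hidden in `ε_i = Θ(ε)`
      ∀ cε cε' : ℝ, C₀ ≤ cε → cε ≤ cε' →
        ∃ C > 0, ∃ ε₀ > 0, ∀ ε : ℝ, 0 < ε → ε < ε₀ →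
          ∀ (η : ℕ → ℝ) (τ : ℝ) (marg : Fin m → ℝ),
            (∀ t, 1 ≤ t → cη * ε ^ 3 ≤ η t ∧ η t ≤ cη' * ε ^ 3) →
            (cτ * ε ≤ τ ∧ τ ≤ cτ' * ε) →
            (∀ i, cε * ε ≤ marg i ∧ marg i ≤ cε' * ε) →
            ∀ t : ℕ, 1 ≤ t → K * (ε ^ 4)⁻¹ * Real.log (1 / ε) ≤ (t : ℝ) →
              let πt := M.flexPolicy (M.slaterGap d₀) η (fun _ => τ) (fun _ => marg) t
              (∀ πopt, M.IsOptimal πopt →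
                max 0 (M.value M.r πopt - M.value M.r πt) ≤ C * ε) ∧
              ∀ i, max 0 (M.α i - M.value (M.d i) πt) = 0 := by
  have : Nonempty A := hSlater.nonempty hm
  have hH := hSlater.horizon_pos hm
  have hH' : (0 : ℝ) < M.H := by exact_mod_cast hH
  have hΞ := hSlater.slaterGap_pos hm
  have hgap := hSlater.slaterGap_le
  set Ξ := M.slaterGap d₀
  obtain ⟨L, hL⟩ : ∃ L, L = 4 * M.H / Ξ := ⟨_, rfl⟩
  have hL0 : 0 ≤ L := by rw [hL]; positivity
  have hl := CMDP.log_card_nonneg A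
  have hB := CMDP.qBound_nonneg (M := M) hL0
  have hE : 0 ≤ M.stepError L := by unfold CMDP.stepError; positivity
  have hcη'0 : 0 < cη' := hcη.trans_le hcη'
  have hcτ'0 : 0 < cτ' := hcτ.trans_le hcτ'
  -- The constant of `klSum_flexPolicy_le`. It does not involve the margins, so the lower bound for
  -- their constant can be fixed before them.
  obtain ⟨D, hD⟩ : ∃ D, D = 3 * (M.H * Real.log (Fintype.card A) + m * L ^ 2)
    + cη' * M.stepError L / cτ := ⟨_, rfl⟩
  have hD0 : 0 ≤ D := by rw [hD]; positivity
  -- The margins must cover the bias `τL` of the saddle constraints and the distance `H (D + H) ε`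
  -- from the iterate to the saddle.
  refine ⟨2 / (cη * cτ), by positivity, cτ' * L + M.H * (D + M.H), by positivity,
    fun cε cε' hcε hcε' => ?_⟩
  have hcε0 : 0 < cε := lt_of_lt_of_le (by positivity) hcε
  have hcε'0 : 0 < cε' := hcε0.trans_le hcε'
  -- `X` collects every smallness requirement: `ε (1 + X) < 1` bounds each of its nonnegative
  -- summands, times `ε`, by 1.
  obtain ⟨X, hX⟩ : ∃ X, X = cη' * (2 * M.qBound L + 1) ^ 2
    + cτ' * (1 + Real.log (Fintype.card A)) + cε' * (1 + 2 / Ξ) := ⟨_, rfl⟩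
  have hX0 : 0 ≤ X := by rw [hX]; positivity
  -- The reward loss has three sources: distance to the saddle, entropy bonus, and price of the
  -- margins.
  refine ⟨M.H * (D + M.H) + cτ' * (M.H * Real.log (Fintype.card A)) + m * L * cε',
    by positivity, 1 / (1 + X), by positivity, ?_⟩
  intro ε hε hε₀ η τ marg hη hτ hmarg t ht1 ht πt
  rw [lt_div_iff₀ (by positivity)] at hε₀
  have hεX : ε * X = cη' * ε * (2 * M.qBound L + 1) ^ 2 + cτ' * ε
      + cτ' * ε * Real.log (Fintype.card A) + cε' * ε + cε' * ε * 2 / Ξ := by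
    rw [hX]; ring
  have hp1 : 0 ≤ cη' * ε * (2 * M.qBound L + 1) ^ 2 := by positivity
  have hp2 : 0 ≤ cτ' * ε := by positivity
  have hp3 : 0 ≤ cτ' * ε * Real.log (Fintype.card A) := by positivity
  have hp4 : 0 ≤ cε' * ε := by positivity
  have hp5 : 0 ≤ cε' * ε * 2 / Ξ := by positivity
  have hε1 : ε ≤ 1 := by nlinarith
  have hτ0 : 0 < τ := lt_of_lt_of_le (by positivity) hτ.1
  have hτ1 : τ ≤ 1 := by linarith [hτ.2]
  have hτl : τ * Real.log (Fintype.card A) < 1 := by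
    have := mul_le_mul_of_nonneg_right hτ.2 hl
    linarith
  have hηB : cη' * ε ^ 3 * (2 * M.qBound L + 1) ^ 2 ≤ 1 := by
    have h1 : ε ^ 3 ≤ ε := pow_le_of_le_one hε.le hε1 (by norm_num)
    have h2 := mul_le_mul_of_nonneg_right (mul_le_mul_of_nonneg_left h1 hcη'0.le)
      (sq_nonneg (2 * M.qBound L + 1))
    linarith
  have hmarg1 : ∀ i, marg i ∈ Set.Icc (0 : ℝ) 1 := fun i =>
    ⟨le_trans (by positivity) (hmarg i).1, by linarith [(hmarg i).2]⟩
  -- The tightened problem keeps half of the Slater gap.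
  have hmargΞ : ∀ i, marg i ≤ Ξ / 2 := fun i => by
    have h1 : cε' * ε * 2 / Ξ ≤ 1 := by linarith
    rw [div_le_one hΞ] at h1
    linarith [(hmarg i).2]
  obtain ⟨π', mu, hs⟩ := CMDP.exists_isSaddle M hτ0 (fun i => M.α i + marg i) hL0
  have hkl := CMDP.klSum_flexPolicy_le (Ξ := Ξ) hL hL0 hH hcη hcη' hcτ hε hτ.1 hτ1 hη hηB hmarg1 hs
    ht1 ht
  rw [← hD] at hkl
  have hadm := CMDP.isAdmissible_flexIterate (Ξ := Ξ) hτ0.le hτ1 hL hL0 hH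
    (fun t ht => le_trans (by positivity) (hη t ht).1)
    (fun t ht => (mul_le_mul_of_nonneg_right (hη t ht).2 (sq_nonneg _)).trans hηB) marg (t - 1)
  have hval : ∀ v : ℕ → S → A → ℝ, (∀ h < M.H, ∀ s a, v h s a ∈ Set.Icc (0 : ℝ) 1) →
      |M.value v π' - M.value v πt| ≤ M.H * (D + M.H) * ε := fun v hv => by
    refine (CMDP.abs_value_sub_value_le hadm.isPolicy hadm.isPosPolicy hs.isPolicy hs.isPosPolicy hv
      hε).trans ?_
    rw [mul_assoc]
    refine mul_le_mul_of_nonneg_left ?_ hH'.le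
    have : M.klSum π' πt / ε ≤ D * ε := by
      rw [div_le_iff₀ hε]
      linarith
    rw [add_mul]
    exact add_le_add this le_rfl
  constructor
  · intro πopt hopt
    refine max_le (by positivity) ?_
    have h1 := hs.value_ge hτ0.le hL0 hopt.1.1
    have h2 : -(m * L * (cε' * ε)) ≤
        ∑ i, mu i * (M.value (M.d i) πopt - (M.α i + marg i)) := by
      have h3 := CMDP.sum_mul_le_card_mul hs.dual_mem (f := marg) fun i =>
        ⟨(hmarg1 i).1, (hmarg i).2⟩
      have h4 : ∑ i, -(mu i * marg i) ≤
          ∑ i, mu i * (M.value (M.d i) πopt - (M.α i + marg i)) :=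
        Finset.sum_le_sum fun i _ => by
          have := mul_nonneg (hs.dual_mem i).1 (sub_nonneg.2 (hopt.1.2 i))
          linarith
      rw [Finset.sum_neg_distrib] at h4
      linarith
    have h5 := (abs_le.1 (hval M.r M.r_mem)).2
    have h6 := mul_le_mul_of_nonneg_right hτ.2 (mul_nonneg hH'.le hl)
    linarith
  · intro i
    refine max_eq_left (sub_nonpos.2 ?_)
    -- The chain is `V_d(πt) ≥ V_d(π') - H (D + H) ε ≥ α + marg - τL - H (D + H) ε ≥ α`.
    have h1 := (hL ▸ hs).constraint_ge hτ0.le hτl hH hΞ hSlater.1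
      (fun i => by linarith [hgap i, hmargΞ i]) i
    rw [← hL] at h1
    have h2 := (abs_le.1 (hval (M.d i) (M.d_mem i))).2
    have h3 := mul_le_mul_of_nonneg_right hτ.2 hL0
    have h4 := mul_le_mul_of_nonneg_right hcε hε.le
    linarith [(hmarg i).1]
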